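/- Fix an error bound $0\le\varepsilon<1/2$. There is a constant $c>0$, depending only on $\varepsilon$, such that the following holds for all integers $n>0$ and $r\ge 2$ with $r\mid n$. Call $f:[n]\to[n]$ $r$-to-one if every value of $f$ is taken exactly $r$ times. Let a function $f:[n]\to[n]$ be given as a quantum oracle $$O_f|i,j,z\rangle=|i,\;f(i)+j \bmod n,\;z\rangle ,$$ where $z$ is the content of a work space of arbitrary finite dimension, with the promise that $f$ is either one-to-one or $r$-to-one. Consider any quantum algorithm that starts in a fixed basis state, alternates $T+1$ unitary operators (which do not depend on $f$) with $T$ applications of $O_f$, measures the final state in the computational basis, and accepts on a fixed set of outcomes. If it accepts every one-to-one $f$ with probability at most $\varepsilon$ and every $r$-to-one $f$ with probability at least $1-\varepsilon$, then $$T\ \ge\ c\,(n/r)^{1/3}.$$ -/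

import Mathlib

noncomputable section

/-- Labels `(i, j, z)` of the computational basis: `i` is a query point, `j` an answer register,
and `z` the content of a work space of arbitrary finite dimension `w`.  The sets `[n]`, `[N]` are
represented by `Fin n`, `Fin N` (residues), so that `+` on `Fin N` is addition modulo `N`. -/
abbrev BasisLabel (n N w : ℕ) : Type := Fin n × Fin N × Fin w

/-- The oracle transformation `O_f`, with `O_f |i, j, z⟩ = |i, f(i) + j mod N, z⟩`.
Column `y` of the matrix is the image of the basis vector labelled `y`. -/
def oracleMatrix {n N : ℕ} (w : ℕ) (f : Fin n → Fin N) :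
    Matrix (BasisLabel n N w) (BasisLabel n N w) ℂ :=
  Matrix.of fun x y => if x = (y.1, f y.1 + y.2.1, y.2.2) then 1 else 0

/-- A quantum query algorithm for functions `[n] → [N]`: it starts in a basis state, alternates
`numQueries + 1` unitary operators (which do not depend on the input function) with `numQueries`
oracle calls, then measures in the computational basis and accepts on a fixed set of outcomes. -/
structure QuantumQueryAlgorithm (n N : ℕ) where
  /-- dimension of the work space -/
  workDim : ℕ
  /-- number of oracle calls -/
  numQueries : ℕ
  /-- the unitary operators; only `U 0, …, U numQueries` are used -/
  U : ℕ → Matrix.unitaryGroup (BasisLabel n N workDim) ℂ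
  /-- the initial basis state -/
  start : BasisLabel n N workDim
  /-- the accepting measurement outcomes -/
  accept : Finset (BasisLabel n N workDim)

namespace QuantumQueryAlgorithm

variable {n N : ℕ}

/-- The state after `k` oracle calls and `k + 1` unitary operators, as a vector of amplitudes. -/
def state (A : QuantumQueryAlgorithm n N) (f : Fin n → Fin N) :
    ℕ → BasisLabel n N A.workDim → ℂ
  | 0 => Matrix.mulVec (A.U 0).1 (Pi.single A.start 1)
  | k + 1 => Matrix.mulVec (A.U (k + 1)).1
      (Matrix.mulVec (oracleMatrix A.workDim f) (state A f k))

/-- The probability that the final measurement gives an accepting outcome on input `f`. -/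
def acceptProb (A : QuantumQueryAlgorithm n N) (f : Fin n → Fin N) : ℝ :=
  ∑ x ∈ A.accept, ‖A.state f A.numQueries x‖ ^ 2

end QuantumQueryAlgorithm

/-- `f` is `r`-to-one: every value of `f` is taken exactly `r` times. -/
def IsToOne {n N : ℕ} (r : ℕ) (f : Fin n → Fin N) : Prop :=
  ∀ y ∈ Set.range f, (Finset.univ.filter fun i => f i = y).card = r

/-- `A` decides, with error probability at most `ε`, whether a function that is promised to be
one-to-one or `r`-to-one is `r`-to-one (accept) or one-to-one (reject). -/
def QuantumQueryAlgorithm.Distinguishes {n N : ℕ} (A : QuantumQueryAlgorithm n N)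
    (r : ℕ) (ε : ℝ) : Prop :=
  (∀ f : Fin n → Fin N, Function.Injective f → A.acceptProb f ≤ ε) ∧
  (∀ f : Fin n → Fin N, IsToOne r f → 1 - ε ≤ A.acceptProb f)

end

/-!
The lower bound is proved by the polynomial method.  After `T` queries, every amplitude is a
polynomial of degree at most `T` in the variables `δ i j = if f i = j then 1 else 0`, and the
acceptance probability is one of degree at most `2 T` (`acceptProb_mem_lowDegree`).  For a function
that has `p` fibres of size `a` and `q` fibres of size `b`, averaging over all permutations of the
domain and of the codomain turns this into a polynomial `Q (p a, q b, a, b)` whose total degree `d`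
is still at most `2 T` (`exists_symmetrized_polynomial`).  It takes values in `[0, 1]` whenever
`p a + q b = n`, is at most `ε` for `a = b = 1`, and at least `1 - ε` for `a = b = r`.

Such a polynomial has `d ^ 3` at least proportional to `n / r` (`degree_cube_ge`).  Let `m` be a
multiple of `r` near `n / 2`, and suppose that `Q (m, n - m, 1, r) ≥ 1 / 2`.  Then
`x ↦ Q (m, n - m, 1, x)` jumps by a constant between `1` and `r`; let `k` be the least positive
integer where its absolute value exceeds a certain constant.  Below `k` it is bounded at the
integers, and Markov's inequality gives `d ^ 2 ≥ c k / r`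
(`degree_sq_ge_of_jump`, `exists_large_value`).  On the other hand, `t ↦ Q (n - k t, k t, 1, k)` is
bounded by `1` at the integers of `[0, n / k]`, but large somewhere in the middle third of this
interval, which forces `d ≥ n / (3 k)` (`min_lt_degree_of_large_value`).  The product of the two
bounds does not depend on `k`.  If `Q (m, n - m, 1, r) < 1 / 2`, the argument is similar, with
`x ↦ Q (m, n - m, r x, r)` and `t ↦ Q (r k t, n - r k t, r k, r)`.

The two facts about real polynomials come from Chebyshev polynomials: Markov's inequality from
their extremal property for derivatives at the end of an interval, and the other one from Lagrange
interpolation at consecutive integers of the product with a localizing factor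
(`exists_localizing_polynomial`).
-/

namespace CollisionLowerBound

open Polynomial

/-! ### Real polynomials bounded at many points -/

/-- The endpoint case of Markov's inequality, transported from `[-1, 1]` to the segment from
`x - 2 * h` to `x`; for negative `h` the point `x` is the left endpoint. -/
lemma derivative_eval_mul_le_of_endpoint {p : ℝ[X]} {d : ℕ} (hp : p.natDegree ≤ d) {x h B : ℝ}
    (hB : 0 < B) (hb : ∀ t ∈ Set.Icc (-1 : ℝ) 1, |p.eval (x - h + h * t)| ≤ B) :
    p.derivative.eval x * h ≤ B * d ^ 2 := by
  set P : ℝ[X] := C B⁻¹ * p.comp (C (x - h) + C h * X) with hP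
  have hdeg : P.degree ≤ d := by
    refine degree_le_of_natDegree_le ?_
    refine (natDegree_C_mul_le _ _).trans ?_
    refine natDegree_comp_le.trans ?_
    have : (C (x - h) + C h * X : ℝ[X]).natDegree ≤ 1 := by compute_degree
    nlinarith
  have hbd : ∀ t ∈ Set.Icc (-1 : ℝ) 1, |P.eval t| ≤ 1 := by
    intro t ht
    have h1 := hb t ht
    simp only [hP, eval_mul, eval_C, eval_comp, eval_add, eval_X, abs_mul, abs_inv,
      abs_of_pos hB]
    rw [inv_mul_le_iff₀ hB]
    simpa using h1
  have key := Chebyshev.eval_iterate_derivative_le_of_forall_abs_le_one (k := 1) le_rfl hdeg hbd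
  simp only [Function.iterate_one, Chebyshev.derivative_T_eval_one] at key
  have hder : P.derivative.eval 1 = B⁻¹ * (p.derivative.eval x * h) := by
    simp only [hP, derivative_mul, derivative_C, zero_mul, zero_add, derivative_comp,
      derivative_add, derivative_X, mul_one, eval_mul, eval_C, eval_comp, eval_add, eval_X]
    rw [sub_add_cancel]
    ring
  rw [hder, inv_mul_le_iff₀ hB] at key
  simpa using key

/-- A form of Markov's inequality, which loses a factor `2` because it is deduced from the endpoint
case on the longer of the two parts into which `x` divides the interval. -/
lemma abs_derivative_eval_le {p : ℝ[X]} {d : ℕ} (hp : p.natDegree ≤ d) {u v B : ℝ} (huv : u < v)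
    (hB : 0 < B) (hb : ∀ y ∈ Set.Icc u v, |p.eval y| ≤ B) {x : ℝ} (hx : x ∈ Set.Icc u v) :
    |p.derivative.eval x| ≤ 4 * d ^ 2 * B / (v - u) := by
  have key : ∀ h : ℝ, (v - u) / 4 ≤ |h| → (∀ t ∈ Set.Icc (-1 : ℝ) 1, x - h + h * t ∈ Set.Icc u v) →
      |p.derivative.eval x| ≤ 4 * d ^ 2 * B / (v - u) := by
    intro h hh hmem
    have h1 := derivative_eval_mul_le_of_endpoint hp hB fun t ht => hb _ (hmem t ht)
    have hpneg : (-p).natDegree ≤ d := by simpa using hp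
    have h2 := derivative_eval_mul_le_of_endpoint (x := x) (h := h) hpneg hB fun t ht => by
      simpa using hb _ (hmem t ht)
    have h3 : |p.derivative.eval x| * |h| ≤ B * d ^ 2 := by
      rw [← abs_mul]
      refine abs_le.2 ⟨?_, h1⟩
      simp only [derivative_neg, eval_neg] at h2
      linarith
    rw [le_div_iff₀ (by linarith)]
    have := mul_le_mul_of_nonneg_left hh (abs_nonneg (p.derivative.eval x))
    linarith
  obtain ⟨hx1, hx2⟩ := hx
  rcases le_total (u + v) (2 * x) with h | h
  · refine key ((x - u) / 2) ?_ ?_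
    · rw [abs_of_nonneg (by linarith)]; linarith
    · rintro t ⟨ht1, ht2⟩
      constructor <;> nlinarith
  · refine key (-((v - x) / 2)) ?_ ?_
    · rw [abs_neg, abs_of_nonneg (by linarith)]; linarith
    · rintro t ⟨ht1, ht2⟩
      constructor <;> nlinarith

lemma abs_eval_sub_eval_le {p : ℝ[X]} {u v K : ℝ}
    (hK : ∀ y ∈ Set.Icc u v, |p.derivative.eval y| ≤ K) {x y : ℝ} (hx : x ∈ Set.Icc u v)
    (hy : y ∈ Set.Icc u v) : |p.eval x - p.eval y| ≤ K * |x - y| :=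
  (convex_Icc u v).norm_image_sub_le_of_norm_deriv_le (f := fun t => p.eval t)
    (fun _ _ => p.differentiableAt) (fun t ht => by simpa using hK t ht) hy hx

/-- A polynomial of small degree that is bounded on a `1`-dense subset of an interval varies slowly
there: a jump of `δ` over a distance `ρ` forces the square of the degree to be at least proportional
to `δ / ρ` times the length of the interval. -/
lemma degree_sq_ge_of_jump {p : ℝ[X]} {d : ℕ} (hp : p.natDegree ≤ d) {u v C₀ δ ρ : ℝ} (huv : u < v)
    (hδ : 0 < δ) (hδC : δ ≤ C₀) (hρ : 1 ≤ ρ)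
    (hnet : ∀ x ∈ Set.Icc u v, ∃ y ∈ Set.Icc u v, |x - y| ≤ 1 ∧ |p.eval y| ≤ C₀)
    {x₁ x₂ : ℝ} (h₁ : x₁ ∈ Set.Icc u v) (h₂ : x₂ ∈ Set.Icc u v) (hdist : |x₁ - x₂| ≤ ρ)
    (hjump : δ ≤ |p.eval x₁ - p.eval x₂|) :
    δ * (v - u) / (8 * C₀ * ρ) ≤ (d : ℝ) ^ 2 := by
  have hC₀ : 0 < C₀ := hδ.trans_le hδC
  have hL : 0 < v - u := sub_pos.2 huv
  by_contra! hcon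
  rw [lt_div_iff₀ (by positivity)] at hcon
  obtain ⟨z, hz, hmax⟩ := isCompact_Icc.exists_isMaxOn (Set.nonempty_Icc.2 huv.le)
    (f := fun t => |p.eval t|) (by fun_prop)
  have hmax' : ∀ y ∈ Set.Icc u v, |p.eval y| ≤ |p.eval z| := fun y hy => hmax hy
  have hBpos : 0 < |p.eval z| := by
    have h3 := hmax' _ h₁
    have h4 := hmax' _ h₂
    have h5 := abs_sub (p.eval x₁) (p.eval x₂)
    linarith
  set B := |p.eval z|
  have hder : ∀ y ∈ Set.Icc u v, |p.derivative.eval y| ≤ 4 * d ^ 2 * B / (v - u) :=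
    fun y hy => abs_derivative_eval_le hp huv hBpos hmax' hy
  set K := 4 * (d : ℝ) ^ 2 * B / (v - u) with hKdef
  have hK0 : 0 ≤ K := by positivity
  have hKmul : K * (v - u) = 4 * d ^ 2 * B := by rw [hKdef]; field_simp
  -- The degree is so small that the derivative is at most half the maximum.
  have hKB : K ≤ B / 2 := by
    have h6 : (d : ℝ) ^ 2 * 8 ≤ v - u := by
      have h7 : (d : ℝ) ^ 2 * 8 * C₀ ≤ (d : ℝ) ^ 2 * (8 * C₀ * ρ) := by
        have : 0 ≤ (d : ℝ) ^ 2 * 8 * C₀ := by positivity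
        nlinarith
      have h8 : δ * (v - u) ≤ C₀ * (v - u) := by gcongr
      by_contra! h9
      have := mul_lt_mul_of_pos_right h9 hC₀
      linarith
    have : K * (v - u) ≤ B / 2 * (v - u) := by
      rw [hKmul]
      nlinarith
    exact le_of_mul_le_mul_right this hL
  have hB2 : B ≤ 2 * C₀ := by
    obtain ⟨y, hy, hzy, hyC⟩ := hnet z hz
    have h6 := abs_eval_sub_eval_le hder hz hy
    have h7 : |p.eval z| ≤ |p.eval y| + |p.eval z - p.eval y| := by
      have := abs_add_le (p.eval y) (p.eval z - p.eval y)
      simpa using this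
    have h8 : K * |z - y| ≤ K * 1 := by gcongr
    change B ≤ _ at h7
    linarith
  have h6 := abs_eval_sub_eval_le hder h₁ h₂
  have h7 : K * |x₁ - x₂| ≤ K * ρ := by gcongr
  have h8 : δ * (v - u) ≤ K * ρ * (v - u) := by gcongr; linarith
  have h9 : K * ρ * (v - u) = 4 * d ^ 2 * B * ρ := by rw [mul_right_comm, hKmul]
  have h10 : 4 * (d : ℝ) ^ 2 * B * ρ ≤ 4 * d ^ 2 * (2 * C₀) * ρ := by gcongr
  linarith

/-! ### Values between consecutive integers -/

lemma prod_range_erase_abs_sub (N a : ℕ) (ha : a ≤ N) :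
    ∏ b ∈ (Finset.range (N + 1)).erase a, |(a : ℝ) - b| = a.factorial * (N - a).factorial := by
  have hsplit : (Finset.range (N + 1)).erase a
      = (Finset.range a).disjUnion (Finset.Ico (a + 1) (N + 1))
        (Finset.disjoint_left.2 fun x => by simp; omega) := by
    ext x; simp; omega
  rw [hsplit, Finset.prod_disjUnion]
  congr 1
  · rw [← Finset.prod_range_reflect, ← Finset.prod_range_add_one_eq_factorial, Nat.cast_prod]
    refine Finset.prod_congr rfl fun x hx => ?_
    have hx' : x + 1 ≤ a := Finset.mem_range.1 hx
    rw [Nat.sub_sub, add_comm 1 x, Nat.cast_sub hx']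
    rw [sub_sub_cancel, abs_of_nonneg (by positivity)]
  · rw [Finset.prod_Ico_eq_prod_range, ← Finset.prod_range_add_one_eq_factorial, Nat.cast_prod,
      show N + 1 - (a + 1) = N - a by omega]
    refine Finset.prod_congr rfl fun x _ => ?_
    push_cast
    rw [show (a : ℝ) - (a + 1 + x) = -(x + 1) by ring, abs_neg, abs_of_nonneg (by positivity)]

lemma factorial_sq_le (R a : ℕ) (ha : a ≤ 2 * R) :
    R.factorial ^ 2 ≤ a.factorial * (2 * R - a).factorial := by
  have h1 := Nat.choose_mul_factorial_mul_factorial ha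
  have h2 : (2 * R).choose R * R.factorial * (2 * R - R).factorial = (2 * R).factorial :=
    Nat.choose_mul_factorial_mul_factorial (by omega)
  rw [show 2 * R - R = R by omega] at h2
  have h3 : (2 * R).choose a ≤ (2 * R).choose R := by
    simpa [Nat.centralBinom] using Nat.choose_le_centralBinom a R
  have h4 : 0 < (2 * R).choose R := Nat.choose_pos (by omega)
  refine Nat.le_of_mul_le_mul_left ?_ h4
  calc (2 * R).choose R * R.factorial ^ 2 = (2 * R).factorial := by rw [← h2]; ring
    _ = (2 * R).choose a * (a.factorial * (2 * R - a).factorial) := by rw [← h1]; ring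
    _ ≤ _ := Nat.mul_le_mul_right _ h3

lemma prod_abs_node_eq (R : ℕ) {θ : ℝ} (h0 : 0 ≤ θ) (h1 : θ ≤ 1) :
    ∏ b ∈ Finset.range (2 * R + 1), |θ - ((b : ℝ) - R)|
      = θ * ∏ t ∈ Finset.range R, (((t : ℝ) + 1) ^ 2 - θ ^ 2) := by
  have hsplit : Finset.range (2 * R + 1) = (Finset.range (R + 1)).disjUnion
      (Finset.Ico (R + 1) (2 * R + 1)) (Finset.disjoint_left.2 fun x => by simp; omega) := by
    ext x; simp; omega
  rw [hsplit, Finset.prod_disjUnion, ← Finset.prod_range_reflect, Finset.prod_range_succ',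
    Finset.prod_Ico_eq_prod_range, show 2 * R + 1 - (R + 1) = R by omega]
  have e1 : ∀ t ∈ Finset.range R,
      |θ - (((R + 1 - 1 - (t + 1) : ℕ) : ℝ) - R)| = (t : ℝ) + 1 + θ := by
    intro t ht
    have ht' : t + 1 ≤ R := Finset.mem_range.1 ht
    rw [show R + 1 - 1 - (t + 1) = R - (t + 1) by omega, Nat.cast_sub ht',
      abs_of_nonneg (by push_cast; linarith [Nat.cast_nonneg (α := ℝ) t])]
    push_cast; ring
  have e2 : ∀ t ∈ Finset.range R,
      |θ - (((R + 1 + t : ℕ) : ℝ) - R)| = (t : ℝ) + 1 - θ := by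
    intro t _
    rw [abs_of_nonpos (by push_cast; linarith [Nat.cast_nonneg (α := ℝ) t])]
    push_cast; ring
  rw [Finset.prod_congr rfl e1, Finset.prod_congr rfl e2]
  have e3 : |θ - (((R + 1 - 1 - 0 : ℕ) : ℝ) - R)| = θ := by simp [abs_of_nonneg h0]
  rw [e3, mul_right_comm, ← Finset.prod_mul_distrib, mul_comm]
  congr 1
  exact Finset.prod_congr rfl fun t _ => by ring

lemma prod_abs_node_le (R : ℕ) (hR : 1 ≤ R) {θ : ℝ} (h0 : 0 ≤ θ) (h1 : θ ≤ 1) :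
    ∏ b ∈ Finset.range (2 * R + 1), |θ - ((b : ℝ) - R)|
      ≤ 2 * min θ (1 - θ) * (R.factorial : ℝ) ^ 2 := by
  rw [prod_abs_node_eq R h0 h1]
  have hfac : ∀ s : Finset ℕ, ∏ t ∈ s, (((t : ℝ) + 1) ^ 2 - θ ^ 2) ≤ ∏ t ∈ s, ((t : ℝ) + 1) ^ 2 :=
    fun s => Finset.prod_le_prod
      (fun t _ => by nlinarith [Nat.cast_nonneg (α := ℝ) t]) (fun t _ => by nlinarith)
  have hsq : (R.factorial : ℝ) ^ 2 = ∏ t ∈ Finset.range R, ((t : ℝ) + 1) ^ 2 := by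
    rw [← Finset.prod_range_add_one_eq_factorial, Nat.cast_prod, Finset.prod_pow]
    push_cast; rfl
  rcases min_cases θ (1 - θ) with ⟨h, _⟩ | ⟨h, _⟩
  · rw [h]
    have := hfac (Finset.range R)
    rw [← hsq] at this
    nlinarith [mul_le_mul_of_nonneg_left this h0, sq_nonneg (R.factorial : ℝ),
      mul_nonneg h0 (sq_nonneg (R.factorial : ℝ))]
  · rw [h, hsq]
    obtain ⟨Q, rfl⟩ : ∃ Q, R = Q + 1 := ⟨R - 1, by omega⟩
    rw [Finset.prod_range_succ', Finset.prod_range_succ']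
    have h2 : ∏ t ∈ Finset.range Q, (((t + 1 : ℕ) : ℝ) + 1) ^ 2
        ≥ ∏ t ∈ Finset.range Q, ((((t + 1 : ℕ) : ℝ) + 1) ^ 2 - θ ^ 2) :=
      Finset.prod_le_prod
        (fun t _ => by push_cast; nlinarith [Nat.cast_nonneg (α := ℝ) t]) (fun t _ => by nlinarith)
    have h3 : 0 ≤ ∏ t ∈ Finset.range Q, (((t + 1 : ℕ) : ℝ) + 1) ^ 2 := by positivity
    set X := ∏ t ∈ Finset.range Q, ((((t + 1 : ℕ) : ℝ) + 1) ^ 2 - θ ^ 2)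
    set Y := ∏ t ∈ Finset.range Q, (((t + 1 : ℕ) : ℝ) + 1) ^ 2
    have h4 : θ * (1 - θ ^ 2) ≤ 2 * (1 - θ) := by nlinarith [mul_nonneg h0 (sub_nonneg.2 h1)]
    have h5 : 0 ≤ θ * (1 - θ ^ 2) := by apply mul_nonneg h0; nlinarith
    calc θ * (X * ((((0 : ℕ) : ℝ) + 1) ^ 2 - θ ^ 2)) = θ * (1 - θ ^ 2) * X := by
          push_cast; ring
      _ ≤ θ * (1 - θ ^ 2) * Y := by gcongr
      _ ≤ 2 * (1 - θ) * Y := by gcongr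
      _ = _ := by push_cast; ring

/-- At a point between the nodes `0` and `1`, the Lagrange basis polynomials for the nodes
`-R, …, R` are bounded independently of `R`. -/
lemma abs_eval_lagrange_basis_le (R : ℕ) (hR : 1 ≤ R) {θ : ℝ} (h0 : 0 < θ) (h1 : θ < 1) {a : ℕ}
    (ha : a ∈ Finset.range (2 * R + 1)) :
    |(Lagrange.basis (Finset.range (2 * R + 1)) (fun b : ℕ => (b : ℝ) - R) a).eval θ| ≤ 2 := by
  have ha' : a ≤ 2 * R := Nat.lt_succ_iff.1 (Finset.mem_range.1 ha)
  rw [Lagrange.basis, eval_prod, Finset.abs_prod]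
  have e1 : ∀ b ∈ (Finset.range (2 * R + 1)).erase a,
      |(Lagrange.basisDivisor ((a : ℝ) - R) ((b : ℝ) - R)).eval θ|
        = |θ - ((b : ℝ) - R)| / |(a : ℝ) - b| := by
    intro b _
    rw [Lagrange.basisDivisor]
    simp only [eval_mul, eval_C, eval_sub, eval_X, abs_mul, abs_inv]
    rw [sub_sub_sub_cancel_right, div_eq_inv_mul]
  rw [Finset.prod_congr rfl e1, Finset.prod_div_distrib, prod_range_erase_abs_sub _ _ ha']
  have hF : (0 : ℝ) < a.factorial * (2 * R - a).factorial := by positivity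
  rw [div_le_iff₀ hF]
  -- The distance from `θ` to a node is at least `min θ (1 - θ)`.
  have hmin : min θ (1 - θ) ≤ |θ - ((a : ℝ) - R)| := by
    rcases le_or_gt a R with h | h
    · have : (a : ℝ) ≤ R := by exact_mod_cast h
      refine (min_le_left _ _).trans ((by linarith : θ ≤ θ - ((a : ℝ) - R)).trans (le_abs_self _))
    · have : (R : ℝ) + 1 ≤ a := by exact_mod_cast h
      refine (min_le_right _ _).trans ((by linarith : 1 - θ ≤ -(θ - ((a : ℝ) - R))).trans
        (neg_le_abs _))
  have hm0 : 0 < min θ (1 - θ) := lt_min h0 (by linarith)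
  have hprod := prod_abs_node_le R hR h0.le h1.le
  rw [← Finset.mul_prod_erase _ _ ha] at hprod
  have hP0 : 0 ≤ ∏ b ∈ (Finset.range (2 * R + 1)).erase a, |θ - ((b : ℝ) - R)| :=
    Finset.prod_nonneg fun _ _ => abs_nonneg _
  have h2 := mul_le_mul_of_nonneg_right hmin hP0
  have h3 : ∏ b ∈ (Finset.range (2 * R + 1)).erase a, |θ - ((b : ℝ) - R)|
      ≤ 2 * (R.factorial : ℝ) ^ 2 := by
    refine le_of_mul_le_mul_left ?_ hm0
    linarith
  have h4 : (R.factorial : ℝ) ^ 2 ≤ a.factorial * (2 * R - a).factorial := by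
    exact_mod_cast factorial_sq_le R a ha'
  linarith

/-- A polynomial of degree at most `R` with value `1` at `θ` which decays like the inverse square of
the distance from `θ`, at the scale `1`, throughout an interval of length proportional to `R`.  It
is a rescaled square of a Chebyshev polynomial of the second kind. -/
lemma exists_localizing_polynomial (R : ℕ) (θ : ℝ) :
    ∃ w : ℝ[X], w.natDegree ≤ R ∧ w.eval θ = 1 ∧
      ∀ x : ℝ, |x - θ| ≤ R + 1 → |w.eval x| ≤ 1 ∧ |w.eval x| * (x - θ) ^ 2 ≤ 64 / 3 := by
  -- The square of `U q`, composed with a quadratic polynomial, has degree `4 q ≤ R`.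
  set q : ℕ := R / 4
  have hm : (R : ℝ) + 1 ≤ 4 * (q + 1) := by
    have : R + 1 ≤ 4 * (q + 1) := by omega
    exact_mod_cast this
  have hq0 : (0 : ℝ) < q + 1 := by positivity
  have hR0 : (0 : ℝ) < R + 1 := by positivity
  set y : ℝ[X] := 1 - C (2 * (R + 1 : ℝ) ^ 2)⁻¹ * (X - C θ) ^ 2 with hy
  set w : ℝ[X] := C ((q + 1 : ℝ) ^ 2)⁻¹ * ((Chebyshev.U ℝ q).comp y) ^ 2 with hw
  have hweval : ∀ x, w.eval x = ((Chebyshev.U ℝ q).eval (y.eval x)) ^ 2 / (q + 1) ^ 2 := by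
    intro x
    simp only [hw, eval_mul, eval_C, eval_pow, eval_comp]
    rw [div_eq_inv_mul]
  have hyeval : ∀ x, y.eval x = 1 - ((x - θ) / (R + 1)) ^ 2 / 2 := by
    intro x
    simp only [hy, eval_sub, eval_one, eval_mul, eval_C, eval_pow, eval_X]
    field_simp
  refine ⟨w, ?_, ?_, ?_⟩
  · refine (natDegree_C_mul_le _ _).trans (natDegree_pow_le.trans ?_)
    have h1 : y.natDegree ≤ 2 := by rw [hy]; compute_degree
    have h2 := natDegree_comp_le (p := Chebyshev.U ℝ q) (q := y)
    rw [Chebyshev.natDegree_U_natCast] at h2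
    have h3 : q * y.natDegree ≤ q * 2 := Nat.mul_le_mul_left _ h1
    omega
  · rw [hweval, hyeval]
    simp only [sub_self, zero_div, ne_eq, OfNat.ofNat_ne_zero, not_false_eq_true, zero_pow,
      sub_zero, Chebyshev.U_eval_one, Int.cast_natCast]
    exact div_self (by positivity)
  · intro x hx
    set z := (x - θ) / (R + 1) with hz
    have hz1 : z ^ 2 ≤ 1 := by
      rw [sq_le_one_iff_abs_le_one, hz, abs_div, abs_of_pos hR0]
      exact (div_le_one hR0).2 hx
    have hxz : x - θ = z * (R + 1) := by rw [hz]; field_simp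
    set s := y.eval x with hs
    have hsz : s = 1 - z ^ 2 / 2 := hyeval x
    have hs1 : |s| ≤ 1 := abs_le.2 ⟨by rw [hsz]; linarith, by rw [hsz]; linarith [sq_nonneg z]⟩
    have hw0 : 0 ≤ w.eval x := by rw [hweval]; positivity
    rw [abs_of_nonneg hw0, hweval, ← hs]
    set V := (Chebyshev.U ℝ q).eval s with hV
    constructor
    · -- `U q` is maximal at `1`, as it is proportional to the derivative of `T (q + 1)`.
      have h1 := Chebyshev.abs_iterate_derivative_T_real_le (q + 1) 1 hs1
      have h2 : ∀ t : ℝ, eval t (((q : ℤ) + 1 : ℤ) : ℝ[X]) = (q : ℝ) + 1 := by simp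
      simp only [Function.iterate_one, Chebyshev.T_derivative_eq_U, eval_mul,
        add_sub_cancel_right, h2, Chebyshev.U_eval_one, Int.cast_natCast] at h1
      rw [← hV, abs_mul, abs_of_pos hq0] at h1
      have h3 : |V| ≤ q + 1 := by
        refine le_of_mul_le_mul_left ?_ hq0
        linarith
      rw [div_le_one (by positivity), ← sq_abs]
      gcongr
    · have h1 : V ^ 2 * (1 - s ^ 2) ≤ 1 := by
        obtain ⟨h2, h3⟩ := abs_le.1 hs1
        have h4 := Chebyshev.U_real_cos (Real.arccos s) q
        rw [Real.cos_arccos h2 h3] at h4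
        have h5 : 1 - s ^ 2 = Real.sin (Real.arccos s) ^ 2 := by
          rw [Real.sin_sq, Real.cos_arccos h2 h3]
        rw [h5, ← mul_pow, h4]
        exact Real.sin_sq_le_one _
      have h2 : 3 / 4 * z ^ 2 ≤ 1 - s ^ 2 := by
        rw [hsz]; nlinarith [mul_nonneg (sq_nonneg z) (sub_nonneg.2 hz1)]
      have h3 : V ^ 2 * z ^ 2 ≤ 4 / 3 := by nlinarith [mul_le_mul_of_nonneg_left h2 (sq_nonneg V)]
      rw [hxz, mul_pow, div_mul_eq_mul_div, div_le_iff₀ (by positivity)]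
      calc V ^ 2 * (z ^ 2 * (R + 1) ^ 2) = V ^ 2 * z ^ 2 * (R + 1 : ℝ) ^ 2 := by ring
        _ ≤ 4 / 3 * (4 * (q + 1 : ℝ)) ^ 2 := by gcongr
        _ = 64 / 3 * (q + 1 : ℝ) ^ 2 := by ring

lemma sum_range_inv_sq_le (R : ℕ) : ∑ t ∈ Finset.range R, (((t : ℝ) + 1) ^ 2)⁻¹ ≤ 2 := by
  have h := sum_Ioo_inv_sq_le (α := ℝ) 0 (R + 1)
  have h2 : ∑ t ∈ Finset.range R, (((t : ℝ) + 1) ^ 2)⁻¹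
      = ∑ i ∈ Finset.Ioo 0 (R + 1), ((i : ℝ) ^ 2)⁻¹ := by
    rw [show Finset.Ioo 0 (R + 1) = Finset.Ico 1 (R + 1) by ext; simp; omega,
      Finset.sum_Ico_eq_sum_range]
    refine Finset.sum_congr (by simp) fun t _ => ?_
    push_cast
    rw [add_comm]
  rw [h2]
  simpa using h

/-- A polynomial of degree at most `R` that is bounded by `1` at the integers `-R, …, R` cannot be
large between `0` and `1`.  Interpolating the polynomial itself would give a bound
logarithmic in `R`; multiplying it by a localizing polynomial first makes the sum of the Lagrange
terms converge. -/
lemma abs_eval_le_of_abs_eval_int_le {h : ℝ[X]} {R : ℕ} (hdeg : h.natDegree ≤ R)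
    (hint : ∀ j : ℤ, |j| ≤ R → |h.eval (j : ℝ)| ≤ 1) {θ : ℝ} (h0 : 0 ≤ θ) (h1 : θ < 1) :
    |h.eval θ| ≤ 200 := by
  rcases h0.eq_or_lt with rfl | hpos
  · simpa using (hint 0 (by simp)).trans (by norm_num)
  rcases Nat.eq_zero_or_pos R with rfl | hR
  · have h2 := hint 0 (by simp)
    rw [eq_C_of_natDegree_le_zero hdeg] at h2 ⊢
    simp only [eval_C] at h2 ⊢
    linarith
  obtain ⟨w, hwdeg, hwθ, hw⟩ := exists_localizing_polynomial R θ
  set s := Finset.range (2 * R + 1) with hs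
  set v : ℕ → ℝ := fun b => (b : ℝ) - R with hv
  have hinj : Set.InjOn v s := by
    intro a _ b _ hab
    simpa [hv] using hab
  have hlag : h * w = Lagrange.interpolate s v fun b => (h * w).eval (v b) := by
    refine Lagrange.eq_interpolate hinj ?_
    rw [hs, Finset.card_range]
    refine degree_le_natDegree.trans_lt ?_
    have := natDegree_mul_le (p := h) (q := w)
    exact_mod_cast (by omega : (h * w).natDegree < 2 * R + 1)
  have hsum : h.eval θ = ∑ b ∈ s, (h * w).eval (v b) * (Lagrange.basis s v b).eval θ := by
    have h2 := congrArg (eval θ) hlag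
    rw [eval_mul, hwθ, mul_one, Lagrange.interpolate_apply, eval_finsetSum] at h2
    rw [h2]
    exact Finset.sum_congr rfl fun b _ => by rw [eval_mul, eval_C]
  have hwle : ∀ b ∈ s, |v b - θ| ≤ R + 1 := by
    intro b hb
    have hb' : (b : ℝ) ≤ 2 * R := by
      exact_mod_cast Nat.lt_succ_iff.1 (Finset.mem_range.1 hb)
    have := Nat.cast_nonneg (α := ℝ) b
    rw [abs_le]
    constructor <;> simp only [hv] <;> linarith
  have hterm : ∀ b ∈ s, |(h * w).eval (v b) * (Lagrange.basis s v b).eval θ|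
      ≤ 2 * |w.eval (v b)| := by
    intro b hb
    have hb1 : |h.eval (v b)| ≤ 1 := by
      have hb2 : b ≤ 2 * R := Nat.lt_succ_iff.1 (Finset.mem_range.1 hb)
      have := hint ((b : ℤ) - R) (abs_le.2 ⟨by omega, by omega⟩)
      simpa [hv] using this
    have hb2 := abs_eval_lagrange_basis_le R hR hpos h1 hb
    rw [abs_mul, eval_mul, abs_mul]
    calc |h.eval (v b)| * |w.eval (v b)| * |(Lagrange.basis s v b).eval θ|
        ≤ 1 * |w.eval (v b)| * 2 := by gcongr
      _ = _ := by ring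
  have hfar : ∀ b ∈ s, ∀ t : ℕ, (t : ℝ) + 1 ≤ |v b - θ| →
      |w.eval (v b)| ≤ 64 / 3 * (((t : ℝ) + 1) ^ 2)⁻¹ := by
    intro b hb t ht
    have h2 := (hw _ (hwle b hb)).2
    rw [← div_eq_mul_inv, le_div_iff₀ (by positivity)]
    refine le_trans ?_ h2
    rw [← sq_abs (v b - θ)]
    gcongr
  have hleft : ∑ b ∈ Finset.range R, |w.eval (v b)| ≤ 128 / 3 := by
    rw [← Finset.sum_range_reflect]
    have : ∀ t ∈ Finset.range R, |w.eval (v (R - 1 - t))| ≤ 64 / 3 * (((t : ℝ) + 1) ^ 2)⁻¹ := by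
      intro t ht
      have ht' : t + 1 ≤ R := Finset.mem_range.1 ht
      refine hfar _ (Finset.mem_range.2 (by omega)) t ?_
      have h3 : v (R - 1 - t) = -((t : ℝ) + 1) := by
        simp only [hv]
        rw [Nat.sub_sub, add_comm 1 t, Nat.cast_sub ht']
        push_cast; ring
      rw [h3]
      refine le_trans ?_ (neg_le_abs _)
      linarith
    refine (Finset.sum_le_sum this).trans ?_
    rw [← Finset.mul_sum]
    linarith [sum_range_inv_sq_le R]
  have hright : ∑ b ∈ Finset.Ico R (2 * R + 1), |w.eval (v b)| ≤ 128 / 3 + 2 := by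
    obtain ⟨Q, rfl⟩ : ∃ Q, R = Q + 1 := ⟨R - 1, by omega⟩
    rw [Finset.sum_Ico_eq_sum_range, show 2 * (Q + 1) + 1 - (Q + 1) = Q + 1 + 1 by omega,
      Finset.sum_range_succ', Finset.sum_range_succ']
    have h3 := (hw _ (hwle (Q + 1 + 0) (Finset.mem_range.2 (by omega)))).1
    have h4 := (hw _ (hwle (Q + 1 + (0 + 1)) (Finset.mem_range.2 (by omega)))).1
    have : ∀ t ∈ Finset.range Q, |w.eval (v (Q + 1 + (t + 1 + 1)))|
        ≤ 64 / 3 * (((t : ℝ) + 1) ^ 2)⁻¹ := by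
      intro t ht
      have ht' : t + 1 ≤ Q := Finset.mem_range.1 ht
      refine hfar _ (Finset.mem_range.2 (by omega)) t ?_
      refine le_trans ?_ (le_abs_self _)
      simp only [hv]
      push_cast
      linarith
    have h5 := Finset.sum_le_sum this
    rw [← Finset.mul_sum] at h5
    linarith [sum_range_inv_sq_le Q]
  have htotal : ∑ b ∈ s, |w.eval (v b)| ≤ 128 / 3 + (128 / 3 + 2) := by
    rw [hs, ← Finset.sum_range_add_sum_Ico _ (show R ≤ 2 * R + 1 by omega)]
    exact add_le_add hleft hright
  rw [hsum]
  refine (Finset.abs_sum_le_sum_abs _ _).trans ((Finset.sum_le_sum hterm).trans ?_)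
  rw [← Finset.mul_sum]
  linarith

/-- If a polynomial is bounded by `1` at the integers of `[0, L]` and large at a point `t₀`,
then its degree exceeds the distance from `t₀` to the ends of the interval. -/
lemma min_lt_degree_of_large_value {h : ℝ[X]} {d : ℕ} (hdeg : h.natDegree ≤ d) {L t₀ : ℝ}
    (hint : ∀ j : ℕ, (j : ℝ) ≤ L → |h.eval (j : ℝ)| ≤ 1) (h0 : 0 ≤ t₀)
    (hlarge : 200 < |h.eval t₀|) : min t₀ (L - t₀) < d := by
  by_contra! hcon
  obtain ⟨hd1, hd2⟩ := le_min_iff.1 hcon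
  -- The integers within `d` of `⌊t₀⌋` all lie in `[0, L]`.
  set u := ⌊t₀⌋₊ with hu
  have hu1 : (u : ℝ) ≤ t₀ := Nat.floor_le h0
  have hu2 : t₀ < u + 1 := Nat.lt_floor_add_one t₀
  have hdu : d ≤ u := Nat.le_floor hd1
  have hcomp : (h.comp (X + C (u : ℝ))).natDegree ≤ d := by
    refine natDegree_comp_le.trans ?_
    rw [natDegree_X_add_C, mul_one]
    exact hdeg
  have key := abs_eval_le_of_abs_eval_int_le (θ := t₀ - u) hcomp (fun j hj => ?_)
    (by linarith) (by linarith)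
  · simp only [eval_comp, eval_add, eval_X, eval_C, sub_add_cancel] at key
    linarith
  · obtain ⟨hj1, hj2⟩ := abs_le.1 hj
    obtain ⟨i, hi⟩ : ∃ i : ℕ, (i : ℤ) = j + u := ⟨(j + u).toNat, by omega⟩
    have hi' : (i : ℝ) = j + u := by exact_mod_cast hi
    have hjd : (j : ℝ) ≤ d := by exact_mod_cast hj2
    have := hint i (by rw [hi']; linarith)
    rw [hi'] at this
    simpa using this

/-! ### Averaging over permutations -/

section Permutations

variable {V W : Type*} [Fintype V] [DecidableEq V] [DecidableEq W]

lemma card_perm_extending {k : ℕ} (ι e : Fin k ↪ V) :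
    (Finset.univ.filter fun σ : Equiv.Perm V => ι.trans σ.toEmbedding = e).card
      = (Fintype.card V - k).factorial := by
  classical
  set e₀ : Set.range ι ≃ Set.range e :=
    (Equiv.ofInjective ι ι.injective).symm.trans (Equiv.ofInjective e e.injective)
  have h1 : ∀ σ : Equiv.Perm V,
      ι.trans σ.toEmbedding = e ↔ ∀ x : Set.range ι, σ x = e₀ x := by
    intro σ
    rw [DFunLike.ext_iff]
    constructor
    · rintro h ⟨_, i, rfl⟩
      simpa [e₀] using h i
    · intro h i
      simpa [e₀] using h ⟨ι i, i, rfl⟩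
  rw [← Fintype.card_subtype, Fintype.card_congr
    ((Equiv.subtypeEquivRight h1).trans (Equiv.Set.compl e₀))]
  have hc : ∀ g : Fin k ↪ V, Fintype.card ((Set.range g)ᶜ : Set V) = Fintype.card V - k := by
    intro g
    rw [Fintype.card_compl_set, Fintype.card_congr (Equiv.ofInjective g g.injective).symm,
      Fintype.card_fin]
  rw [Fintype.card_equiv (Fintype.equivOfCardEq ((hc ι).trans (hc e).symm)), hc]

lemma sum_perm_eq_sum_embedding {k : ℕ} (ι : Fin k ↪ V) (G : (Fin k ↪ V) → ℝ) :
    ∑ σ : Equiv.Perm V, G (ι.trans σ.toEmbedding)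
      = (Fintype.card V - k).factorial * ∑ d : Fin k ↪ V, G d := by
  rw [← Finset.sum_fiberwise (s := Finset.univ)
    (g := fun σ : Equiv.Perm V => ι.trans σ.toEmbedding), Finset.mul_sum]
  refine Finset.sum_congr rfl fun d _ => ?_
  rw [Finset.sum_congr rfl fun σ hσ => by rw [(Finset.mem_filter.1 hσ).2],
    Finset.sum_const, card_perm_extending, nsmul_eq_mul]

/-! ### Sums over injections -/

/-- The first point of an injection takes all values except those taken by the other points. -/
lemma sum_embedding_succ [Fintype W] {k : ℕ} (G : Fin k → W → ℝ) (g : W → ℝ) :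
    ∑ e : Fin (k + 1) ↪ W, g (e 0) * ∏ j, G j (e j.succ)
      = ∑ e : Fin k ↪ W, (∑ y, g y - ∑ j, g (e j)) * ∏ j, G j (e j) := by
  classical
  rw [← (Equiv.embeddingFinSucc k W).symm.sum_comp, Fintype.sum_sigma]
  refine Finset.sum_congr rfl fun e _ => ?_
  simp only [Equiv.coe_embeddingFinSucc_symm, Fin.cons_zero, Fin.cons_succ]
  rw [← Finset.sum_mul]
  congr 1
  have h1 : ∑ j, g (e j) = ∑ y with y ∈ Set.range e, g y := by
    rw [← Finset.sum_map Finset.univ e g]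
    refine Finset.sum_congr ?_ fun _ _ => rfl
    ext y; simp
  rw [h1, eq_sub_iff_add_eq, ← Finset.sum_filter_not_add_sum_filter Finset.univ
    (fun y => y ∈ Set.range e) g]
  congr 1
  rw [Finset.sum_subtype (p := fun y => y ∉ Set.range e)]
  simp

/-- The injections of `Fin k` that map each point `i` into the fibre of `f` over `e (s i)` are
counted by a product of polynomials in the sizes of these fibres.  The polynomial for `j` has the
size of the fibre of `s` over `j` as a bound for its degree, and no constant term if this fibre is
nonempty. -/
lemma exists_fibre_count_polynomials {m k : ℕ} (s : Fin k → Fin m) :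
    ∃ φ : Fin m → ℝ[X], (∀ j, (φ j).natDegree ≤ (Finset.univ.filter fun i => s i = j).card) ∧
      (∀ i, X ∣ φ (s i)) ∧ ∀ (f : V → W) (e : Fin m ↪ W),
        ∑ d : Fin k ↪ V, ∏ i, (if f (d i) = e (s i) then (1 : ℝ) else 0)
          = ∏ j, (φ j).eval ((Finset.univ.filter fun x => f x = e j).card : ℝ) := by
  induction k with
  | zero => exact ⟨fun _ => 1, by simp, fun i => i.elim0, by simp⟩
  | succ k ih =>
    obtain ⟨φ, hdeg, hdvd, hsum⟩ := ih fun i => s i.succ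
    set n₀ := (Finset.univ.filter fun i : Fin k => s i.succ = s 0).card with hn₀
    refine ⟨fun j => φ j * if j = s 0 then X - C (n₀ : ℝ) else 1, ?_, ?_, ?_⟩
    · intro j
      rw [Finset.card_filter, Fin.sum_univ_succ, ← Finset.card_filter]
      refine natDegree_mul_le.trans ((add_comm _ _).trans_le (add_le_add ?_ (hdeg j)))
      by_cases hj : j = s 0
      · rw [if_pos hj, if_pos hj.symm]
        exact natDegree_X_sub_C_le _
      · simp [hj]
    · intro i
      refine Fin.cases ?_ (fun i => (hdvd i).mul_right _) i
      simp only [if_true]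
      by_cases h0 : n₀ = 0
      · simp [h0]
      · obtain ⟨i, hi⟩ := Finset.card_pos.1 (Nat.pos_of_ne_zero h0)
        exact (Finset.mem_filter.1 hi).2 ▸ (hdvd i).mul_right _
    · intro f e
      have h1 := sum_embedding_succ
        (fun (i : Fin k) x => if f x = e (s i.succ) then (1 : ℝ) else 0)
        (fun x => if f x = e (s 0) then (1 : ℝ) else 0)
      simp only [Fin.prod_univ_succ]
      rw [h1]
      have h2 : ∀ d : Fin k ↪ V, (∑ x, (if f x = e (s 0) then (1 : ℝ) else 0)
          - ∑ i, if f (d i) = e (s 0) then (1 : ℝ) else 0)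
            * ∏ i, (if f (d i) = e (s i.succ) then (1 : ℝ) else 0)
          = ((Finset.univ.filter fun x => f x = e (s 0)).card - n₀)
            * ∏ i, (if f (d i) = e (s i.succ) then (1 : ℝ) else 0) := by
        intro d
        by_cases hd : ∀ i, f (d i) = e (s i.succ)
        · simp only [hd, e.injective.eq_iff, Finset.sum_boole, hn₀]
        · obtain ⟨i, hi⟩ := not_forall.1 hd
          rw [Finset.prod_eq_zero (Finset.mem_univ i) (by simp [hi])]
          simp
      rw [Finset.sum_congr rfl fun d _ => h2 d, ← Finset.mul_sum, hsum]
      simp only [eval_mul, Finset.prod_mul_distrib]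
      rw [mul_comm]
      congr 1
      rw [Finset.prod_eq_single (s 0)]
      · simp
      · intro j _ hj; simp [hj]
      · simp

end Permutations

/-- The sizes of the fibres of a function with values in `Y`: they are `a` on `S`, `b` on `S'`, and
`0` elsewhere. -/
structure IsTwoSized {Y : Type*} (c : Y → ℕ) (a b : ℕ) (S S' : Finset Y) : Prop where
  disjoint : Disjoint S S'
  eq_left : ∀ y ∈ S, c y = a
  eq_right : ∀ y ∈ S', c y = b
  eq_zero : ∀ y, y ∉ S → y ∉ S' → c y = 0

/-- The point at which the polynomials below are evaluated: the number of points of the domain in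
fibres of size `a`, the number of those in fibres of size `b`, and the two sizes. -/
def fibreParams {Y : Type*} (a b : ℕ) (S S' : Finset Y) : Fin 4 → ℝ :=
  ![S.card * a, S'.card * b, a, b]

lemma totalDegree_aeval_X_le (ψ : ℝ[X]) (i : Fin 4) :
    (aeval (MvPolynomial.X i : MvPolynomial (Fin 4) ℝ) ψ).totalDegree ≤ ψ.natDegree := by
  rw [aeval_eq_sum_range]
  refine MvPolynomial.totalDegree_finsetSum_le fun j hj => ?_
  refine (MvPolynomial.totalDegree_smul_le _ _).trans ?_
  rw [MvPolynomial.totalDegree_X_pow]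
  exact Nat.lt_succ_iff.1 (Finset.mem_range.1 hj)

lemma sum_eval_of_isTwoSized {Y : Type*} [Fintype Y] [DecidableEq Y] {c : Y → ℕ} {a b : ℕ}
    {S S' : Finset Y} (hc : IsTwoSized c a b S S') (ψ : ℝ[X]) :
    ∑ y, (X * ψ).eval (c y : ℝ) = S.card * a * ψ.eval (a : ℝ) + S'.card * b * ψ.eval (b : ℝ) := by
  have h1 : ∑ y, (X * ψ).eval (c y : ℝ) = ∑ y ∈ S ∪ S', (X * ψ).eval (c y : ℝ) := by
    refine (Finset.sum_subset (Finset.subset_univ _) fun y _ hy => ?_).symm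
    rw [Finset.mem_union, not_or] at hy
    simp [hc.eq_zero y hy.1 hy.2]
  rw [h1, Finset.sum_union hc.disjoint, Finset.sum_congr rfl fun y hy => by rw [hc.eq_left y hy],
    Finset.sum_congr (s₁ := S') rfl fun y hy => by rw [hc.eq_right y hy]]
  simp only [eval_mul, eval_X, Finset.sum_const, nsmul_eq_mul]
  ring

/-- A sum over injections of products of polynomials without constant term in the fibre sizes is a
polynomial in the parameters `(|S| a, |S'| b, a, b)`.  The absence of constant terms is what makes
the numbers `|S|` and `|S'|` enter only through the products `|S| a` and `|S'| b`.  In the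
induction, the first point runs over all values except those taken by the other points; each
excluded value merges two of the polynomials into their product. -/
lemma exists_mvPolynomial_sum_embedding (Y : Type*) [Fintype Y] [DecidableEq Y] {k : ℕ}
    (φ : Fin k → ℝ[X]) (t : Fin k → ℕ) (hφ : ∀ j, X ∣ φ j) (ht : ∀ j, (φ j).natDegree ≤ t j) :
    ∃ F : MvPolynomial (Fin 4) ℝ, F.totalDegree ≤ ∑ j, t j ∧
      ∀ (c : Y → ℕ) (a b : ℕ) (S S' : Finset Y), IsTwoSized c a b S S' →
        ∑ e : Fin k ↪ Y, ∏ j, (φ j).eval (c (e j) : ℝ)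
          = MvPolynomial.eval (fibreParams a b S S') F := by
  induction k with
  | zero => exact ⟨1, by simp, by simp⟩
  | succ k ih =>
    obtain ⟨ψ, hψ⟩ := hφ 0
    obtain ⟨F, hFdeg, hF⟩ := ih (fun j => φ j.succ) (fun j => t j.succ) (fun j => hφ _)
      fun j => ht _
    have hmerge : ∀ i : Fin k, ∃ G : MvPolynomial (Fin 4) ℝ, G.totalDegree ≤ ∑ j, t j ∧
        ∀ (c : Y → ℕ) (a b : ℕ) (S S' : Finset Y), IsTwoSized c a b S S' →
          ∑ e : Fin k ↪ Y, (φ 0).eval (c (e i) : ℝ) * ∏ j, (φ j.succ).eval (c (e j) : ℝ)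
            = MvPolynomial.eval (fibreParams a b S S') G := by
      intro i
      obtain ⟨G, hGdeg, hG⟩ := ih (fun j => φ j.succ * if j = i then φ 0 else 1)
        (fun j => t j.succ + if j = i then t 0 else 0) (fun j => (hφ _).mul_right _)
        (fun j => by
          refine natDegree_mul_le.trans (add_le_add (ht _) ?_)
          split_ifs
          · exact ht 0
          · simp)
      refine ⟨G, hGdeg.trans_eq ?_, fun c a b S S' hc => ?_⟩
      · rw [Finset.sum_add_distrib, Fin.sum_univ_succ, add_comm]
        simp
      · rw [← hG c a b S S' hc]
        refine Finset.sum_congr rfl fun e _ => ?_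
        simp only [eval_mul, Finset.prod_mul_distrib]
        rw [mul_comm]
        congr 1
        rw [Finset.prod_eq_single i]
        · simp
        · intro j _ hj; simp [hj]
        · simp
    choose G hGdeg hG using hmerge
    refine ⟨(MvPolynomial.X 0 * aeval (MvPolynomial.X 2) ψ
      + MvPolynomial.X 1 * aeval (MvPolynomial.X 3) ψ) * F - ∑ i, G i, ?_, ?_⟩
    · have hlin : ∀ i j : Fin 4, ψ ≠ 0 → (MvPolynomial.X i *
          aeval (MvPolynomial.X j : MvPolynomial (Fin 4) ℝ) ψ).totalDegree ≤ t 0 := by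
        intro i j h0
        refine (MvPolynomial.totalDegree_mul _ _).trans ?_
        rw [MvPolynomial.totalDegree_X]
        have h1 := totalDegree_aeval_X_le ψ j
        have h2 := ht 0
        rw [hψ, natDegree_X_mul h0] at h2
        omega
      have hfirst : (MvPolynomial.X 0 * aeval (MvPolynomial.X 2 : MvPolynomial (Fin 4) ℝ) ψ
          + MvPolynomial.X 1 * aeval (MvPolynomial.X 3) ψ).totalDegree ≤ t 0 := by
        by_cases h0 : ψ = 0
        · simp [h0]
        · exact (MvPolynomial.totalDegree_add _ _).trans (max_le (hlin _ _ h0) (hlin _ _ h0))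
      refine (MvPolynomial.totalDegree_sub _ _).trans (max_le ?_ ?_)
      · rw [Fin.sum_univ_succ]
        exact (MvPolynomial.totalDegree_mul _ _).trans (add_le_add hfirst hFdeg)
      · exact MvPolynomial.totalDegree_finsetSum_le fun i _ => hGdeg i
    · intro c a b S S' hc
      have h1 := sum_embedding_succ (fun (j : Fin k) (y : Y) => (φ j.succ).eval (c y : ℝ))
        (fun y => (φ 0).eval (c y : ℝ))
      simp only [Fin.prod_univ_succ]
      rw [h1]
      have h3 : ∀ (x : ℝ) (f : Fin k → (Fin k ↪ Y) → ℝ) (P : (Fin k ↪ Y) → ℝ),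
          ∑ e, (x - ∑ i, f i e) * P e = x * ∑ e, P e - ∑ i, ∑ e, f i e * P e := by
        intro x f P
        rw [Finset.sum_comm (s := Finset.univ (α := Fin k)), Finset.mul_sum,
          ← Finset.sum_sub_distrib]
        exact Finset.sum_congr rfl fun e _ => by rw [sub_mul, Finset.sum_mul]
      rw [h3]
      simp only [map_sub, map_sum, map_mul, map_add]
      rw [← hF c a b S S' hc, Finset.sum_congr rfl fun i _ => hG i c a b S S' hc]
      congr 2
      rw [hψ, sum_eval_of_isTwoSized hc]
      have h2 : ∀ j : Fin 4, MvPolynomial.eval (fibreParams a b S S')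
          (aeval (MvPolynomial.X j) ψ) = ψ.eval (fibreParams a b S S' j) := by
        intro j
        rw [aeval_def, hom_eval₂, MvPolynomial.eval_X,
          eval₂_congr (RingHom.ext fun x => ?_) rfl rfl, eval₂_id]
        simp
      rw [h2, h2]
      simp [fibreParams]

/-! ### Functions of low degree in the input -/

section LowDegree

variable {V W : Type*} [DecidableEq V] [DecidableEq W]

/-- The monomial that indicates whether the graph of `f` contains `S`. -/
def graphIndicator (S : Finset (V × W)) (f : V → W) : ℝ :=
  if ∀ p ∈ S, f p.1 = p.2 then 1 else 0

/-- The real-valued functions of `f : V → W` that are polynomials of degree at most `d` in the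
variables `δ i j = if f i = j then 1 else 0`.  As `δ i j` is idempotent, monomials are indexed by
sets. -/
def lowDegree (V W : Type*) [DecidableEq V] [DecidableEq W] (d : ℕ) :
    Submodule ℝ ((V → W) → ℝ) :=
  Submodule.span ℝ (graphIndicator '' {S | S.card ≤ d})

lemma graphIndicator_mul (S S' : Finset (V × W)) :
    graphIndicator S * graphIndicator S' = graphIndicator (S ∪ S') := by
  funext f
  simp only [Pi.mul_apply, graphIndicator, Finset.forall_mem_union, ite_and, ite_mul, one_mul,
    zero_mul]

lemma graphIndicator_mem {S : Finset (V × W)} {d : ℕ} (h : S.card ≤ d) :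
    graphIndicator S ∈ lowDegree V W d :=
  Submodule.subset_span ⟨S, h, rfl⟩

lemma mul_mem_lowDegree {d d' : ℕ} {P Q : (V → W) → ℝ} (hP : P ∈ lowDegree V W d)
    (hQ : Q ∈ lowDegree V W d') : P * Q ∈ lowDegree V W (d + d') := by
  have h := Submodule.mul_mem_mul hP hQ
  rw [lowDegree, lowDegree, Submodule.span_mul_span] at h
  refine Submodule.span_mono ?_ h
  rintro _ ⟨_, ⟨S, hS, rfl⟩, _, ⟨S', hS', rfl⟩, rfl⟩
  exact ⟨S ∪ S', (Finset.card_union_le _ _).trans (add_le_add hS hS'),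
    (graphIndicator_mul S S').symm⟩

variable [Fintype V] [Fintype W]

/-- Averaging a monomial over all ways of permuting the domain and the codomain.  The permutations
matter only on the points of `S` and on their values, so that injections can be summed instead:
first those of the points, for which the numbers of choices depend on fibre sizes, and then those of
the values.  A set `S` that assigns two values to a point contributes zero. -/
lemma exists_mvPolynomial_graphIndicator (S : Finset (V × W)) :
    ∃ F : MvPolynomial (Fin 4) ℝ, F.totalDegree ≤ S.card ∧
      ∀ (f : V → W) (a b : ℕ) (A B : Finset W),
        IsTwoSized (fun y => (Finset.univ.filter fun x => f x = y).card) a b A B →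
          ∑ σ : Equiv.Perm V, ∑ τ : Equiv.Perm W, graphIndicator S (τ ∘ f ∘ σ)
            = MvPolynomial.eval (fibreParams a b A B) F := by
  by_cases hS : ∀ p ∈ S, ∀ q ∈ S, p.1 = q.1 → p = q
  swap
  · refine ⟨0, by simp, fun f a b A B _ => ?_⟩
    rw [map_zero]
    refine Finset.sum_eq_zero fun σ _ => Finset.sum_eq_zero fun τ _ => if_neg fun h => hS ?_
    intro p hp q hq hpq
    exact Prod.ext hpq (by rw [← h p hp, ← h q hq, hpq])
  set en : Fin S.card ≃ S := S.equivFin.symm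
  set J := S.image Prod.snd with hJ
  set en' : Fin J.card ≃ J := J.equivFin.symm
  let ι : Fin S.card ↪ V := ⟨fun i => (en i).1.1, fun i i' h =>
    en.injective (Subtype.ext (hS _ (en i).2 _ (en i').2 h))⟩
  let κ : Fin J.card ↪ W := ⟨fun j => (en' j).1, fun j j' h => en'.injective (Subtype.ext h)⟩
  let s : Fin S.card → Fin J.card := fun i =>
    en'.symm ⟨(en i).1.2, Finset.mem_image_of_mem _ (en i).2⟩
  have hι : ∀ i, ι i = (en i).1.1 := fun _ => rfl
  have hκs : ∀ i, κ (s i) = (en i).1.2 := fun i =>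
    congrArg Subtype.val (en'.apply_symm_apply _)
  have hsurj : ∀ j, ∃ i, s i = j := by
    intro j
    obtain ⟨p, hp, hpj⟩ := Finset.mem_image.1 (en' j).2
    refine ⟨en.symm ⟨p, hp⟩, ?_⟩
    rw [Equiv.symm_apply_eq]
    simp [hpj]
  have hind : ∀ f : V → W, graphIndicator S f
      = ∏ i, if f (ι i) = κ (s i) then (1 : ℝ) else 0 := by
    intro f
    rw [Finset.prod_boole, graphIndicator]
    by_cases h : ∀ p ∈ S, f p.1 = p.2
    · rw [if_pos h, if_pos fun i _ => ?_]
      rw [hκs]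
      exact h _ (en i).2
    · rw [if_neg h, if_neg fun h' => h fun p hp => ?_]
      have := h' (en.symm ⟨p, hp⟩) (Finset.mem_univ _)
      rw [hκs, hι] at this
      simpa using this
  obtain ⟨φ, hdeg, hdvd, hφ⟩ := exists_fibre_count_polynomials (V := V) (W := W) s
  obtain ⟨F, hFdeg, hF⟩ := exists_mvPolynomial_sum_embedding W φ _
    (fun j => by obtain ⟨i, rfl⟩ := hsurj j; exact hdvd i) hdeg
  set c : ℝ := (Fintype.card V - S.card).factorial * (Fintype.card W - J.card).factorial with hc
  refine ⟨MvPolynomial.C c * F, ?_, fun f a b A B hf => ?_⟩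
  · refine (MvPolynomial.totalDegree_mul _ _).trans ?_
    rw [MvPolynomial.totalDegree_C, zero_add]
    refine hFdeg.trans_eq ?_
    rw [← Finset.card_eq_sum_card_fiberwise (fun _ _ => Finset.mem_coe.2 (Finset.mem_univ _)),
      Finset.card_univ, Fintype.card_fin]
  · rw [Finset.sum_comm, ← Equiv.sum_comp (Equiv.inv (Equiv.Perm W)), map_mul, MvPolynomial.eval_C,
      ← hF _ _ _ _ _ hf]
    have h1 : ∀ τ : Equiv.Perm W, ∑ σ : Equiv.Perm V, 
        graphIndicator S ((τ⁻¹ : Equiv.Perm W) ∘ f ∘ σ)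
        = (Fintype.card V - S.card).factorial * ∏ j, (φ j).eval
          ((Finset.univ.filter fun x => f x = κ.trans τ.toEmbedding j).card : ℝ) := by
      intro τ
      rw [← hφ, ← sum_perm_eq_sum_embedding ι]
      refine Finset.sum_congr rfl fun σ _ => ?_
      rw [hind]
      refine Finset.prod_congr rfl fun i _ => if_congr ?_ rfl rfl
      simp [Equiv.symm_apply_eq]
    simp only [Equiv.inv_apply]
    rw [Finset.sum_congr rfl fun τ _ => h1 τ, ← Finset.mul_sum, sum_perm_eq_sum_embedding κ
      fun e => ∏ j, (φ j).eval ((Finset.univ.filter fun x => f x = e j).card : ℝ), mul_assoc]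

/-- The sum of a function of degree at most `d` over all ways of permuting the domain and the
codomain of `f` depends on the fibre sizes of `f` only, and polynomially so. -/
lemma exists_mvPolynomial_average {d : ℕ} {P : (V → W) → ℝ} (hP : P ∈ lowDegree V W d) :
    ∃ F : MvPolynomial (Fin 4) ℝ, F.totalDegree ≤ d ∧
      ∀ (f : V → W) (a b : ℕ) (A B : Finset W),
        IsTwoSized (fun y => (Finset.univ.filter fun x => f x = y).card) a b A B →
          ∑ σ : Equiv.Perm V, ∑ τ : Equiv.Perm W, P (τ ∘ f ∘ σ)
            = MvPolynomial.eval (fibreParams a b A B) F := by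
  induction hP using Submodule.span_induction with
  | mem P hP =>
    obtain ⟨S, hS, rfl⟩ := hP
    obtain ⟨F, hF, h⟩ := exists_mvPolynomial_graphIndicator S
    exact ⟨F, hF.trans hS, h⟩
  | zero => exact ⟨0, by simp, by simp⟩
  | add P Q _ _ ihP ihQ =>
    obtain ⟨F, hF, h⟩ := ihP
    obtain ⟨G, hG, h'⟩ := ihQ
    refine ⟨F + G, (MvPolynomial.totalDegree_add _ _).trans (max_le hF hG),
      fun f a b A B hf => ?_⟩
    simp only [Pi.add_apply, Finset.sum_add_distrib, map_add, h f a b A B hf, h' f a b A B hf]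
  | smul c P _ ih =>
    obtain ⟨F, hF, h⟩ := ih
    refine ⟨MvPolynomial.C c * F, (MvPolynomial.totalDegree_mul _ _).trans (by simpa using hF),
      fun f a b A B hf => ?_⟩
    simp only [Pi.smul_apply, smul_eq_mul, ← Finset.mul_sum, map_mul, MvPolynomial.eval_C,
      h f a b A B hf]

end LowDegree

/-! ### Acceptance probabilities -/

variable {n N : ℕ}

lemma oracle_entry_mem_lowDegree (w : ℕ) (x y : BasisLabel n N w) :
    (fun f : Fin n → Fin N => (oracleMatrix w f x y).re) ∈ lowDegree (Fin n) (Fin N) 1 ∧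
      ∀ f : Fin n → Fin N, (oracleMatrix w f x y).im = 0 := by
  constructor
  · have h : (fun f : Fin n → Fin N => (oracleMatrix w f x y).re)
        = ∑ v : Fin N, (if x = (y.1, v + y.2.1, y.2.2) then (1 : ℝ) else 0)
          • graphIndicator {(y.1, v)} := by
      funext f
      rw [Finset.sum_apply, Finset.sum_eq_single (f y.1)]
      · simp [oracleMatrix, graphIndicator, apply_ite Complex.re]
      · intro v _ hv
        simp [graphIndicator, hv.symm]
      · simp
    rw [h]
    exact Submodule.sum_mem _ fun v _ => Submodule.smul_mem _ _ (graphIndicator_mem (by simp))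
  · intro f
    simp only [oracleMatrix, Matrix.of_apply]
    split_ifs <;> simp

lemma lowDegree_mulVec_const {w k : ℕ} (U : Matrix (BasisLabel n N w) (BasisLabel n N w) ℂ)
    {ψ : (Fin n → Fin N) → BasisLabel n N w → ℂ}
    (hre : ∀ x, (fun f => (ψ f x).re) ∈ lowDegree (Fin n) (Fin N) k)
    (him : ∀ x, (fun f => (ψ f x).im) ∈ lowDegree (Fin n) (Fin N) k) (x : BasisLabel n N w) :
    (fun f => (U.mulVec (ψ f) x).re) ∈ lowDegree (Fin n) (Fin N) k ∧
      (fun f => (U.mulVec (ψ f) x).im) ∈ lowDegree (Fin n) (Fin N) k := by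
  constructor
  · have h : (fun f => (U.mulVec (ψ f) x).re)
        = ∑ y, ((U x y).re • (fun f => (ψ f y).re) - (U x y).im • fun f => (ψ f y).im) := by
      funext f
      simp [Matrix.mulVec, dotProduct, Finset.sum_apply]
    rw [h]
    exact Submodule.sum_mem _ fun y _ => Submodule.sub_mem _
      (Submodule.smul_mem _ _ (hre y)) (Submodule.smul_mem _ _ (him y))
  · have h : (fun f => (U.mulVec (ψ f) x).im)
        = ∑ y, ((U x y).re • (fun f => (ψ f y).im) + (U x y).im • fun f => (ψ f y).re) := by
      funext f
      simp [Matrix.mulVec, dotProduct, Finset.sum_apply]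
    rw [h]
    exact Submodule.sum_mem _ fun y _ => Submodule.add_mem _
      (Submodule.smul_mem _ _ (him y)) (Submodule.smul_mem _ _ (hre y))

lemma lowDegree_mulVec_oracle {w k : ℕ} {ψ : (Fin n → Fin N) → BasisLabel n N w → ℂ}
    (hre : ∀ x, (fun f => (ψ f x).re) ∈ lowDegree (Fin n) (Fin N) k)
    (him : ∀ x, (fun f => (ψ f x).im) ∈ lowDegree (Fin n) (Fin N) k) (x : BasisLabel n N w) :
    (fun f => ((oracleMatrix w f).mulVec (ψ f) x).re) ∈ lowDegree (Fin n) (Fin N) (k + 1) ∧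
      (fun f => ((oracleMatrix w f).mulVec (ψ f) x).im) ∈ lowDegree (Fin n) (Fin N) (k + 1) := by
  constructor
  · have h : (fun f => ((oracleMatrix w f).mulVec (ψ f) x).re)
        = ∑ y, (fun f => (ψ f y).re) * fun f => (oracleMatrix w f x y).re := by
      funext f
      simp [Matrix.mulVec, dotProduct, Finset.sum_apply, (oracle_entry_mem_lowDegree w x _).2,
        mul_comm]
    rw [h]
    exact Submodule.sum_mem _ fun y _ =>
      mul_mem_lowDegree (hre y) (oracle_entry_mem_lowDegree w x y).1
  · have h : (fun f => ((oracleMatrix w f).mulVec (ψ f) x).im)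
        = ∑ y, (fun f => (ψ f y).im) * fun f => (oracleMatrix w f x y).re := by
      funext f
      simp [Matrix.mulVec, dotProduct, Finset.sum_apply, (oracle_entry_mem_lowDegree w x _).2,
        mul_comm]
    rw [h]
    exact Submodule.sum_mem _ fun y _ =>
      mul_mem_lowDegree (him y) (oracle_entry_mem_lowDegree w x y).1

lemma lowDegree_const {V W : Type*} [DecidableEq V] [DecidableEq W] (c : ℝ) (d : ℕ) :
    (fun _ => c) ∈ lowDegree V W d := by
  have h : (fun _ : V → W => c) = c • graphIndicator ∅ := by
    funext f; simp [graphIndicator]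
  rw [h]
  exact Submodule.smul_mem _ _ (graphIndicator_mem (by simp))

lemma state_mem_lowDegree (A : QuantumQueryAlgorithm n N) (k : ℕ) (x : BasisLabel n N A.workDim) :
    (fun f => (A.state f k x).re) ∈ lowDegree (Fin n) (Fin N) k ∧
      (fun f => (A.state f k x).im) ∈ lowDegree (Fin n) (Fin N) k := by
  induction k generalizing x with
  | zero =>
    simp only [QuantumQueryAlgorithm.state]
    exact ⟨lowDegree_const _ _, lowDegree_const _ _⟩
  | succ k ih =>
    have h := lowDegree_mulVec_oracle (fun x => (ih x).1) fun x => (ih x).2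
    exact lowDegree_mulVec_const _ (fun x => (h x).1) (fun x => (h x).2) x

/-- Each oracle call raises the degree of the amplitudes by at most one. -/
lemma acceptProb_mem_lowDegree (A : QuantumQueryAlgorithm n N) :
    A.acceptProb ∈ lowDegree (Fin n) (Fin N) (2 * A.numQueries) := by
  have h : A.acceptProb = ∑ x ∈ A.accept,
      ((fun f => (A.state f A.numQueries x).re) * (fun f => (A.state f A.numQueries x).re)
        + (fun f => (A.state f A.numQueries x).im) * fun f => (A.state f A.numQueries x).im) := by
    funext f
    simp [QuantumQueryAlgorithm.acceptProb, Finset.sum_apply, Complex.sq_norm, Complex.normSq_apply]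
  rw [h, two_mul]
  refine Submodule.sum_mem _ fun x _ => ?_
  obtain ⟨h1, h2⟩ := state_mem_lowDegree A A.numQueries x
  exact Submodule.add_mem _ (mul_mem_lowDegree h1 h1) (mul_mem_lowDegree h2 h2)

lemma sum_norm_sq_mulVec_of_unitary {ι : Type*} [Fintype ι] [DecidableEq ι]
    {U : Matrix ι ι ℂ} (hU : U ∈ Matrix.unitaryGroup ι ℂ) (ψ : ι → ℂ) :
    ∑ x, ‖U.mulVec ψ x‖ ^ 2 = ∑ x, ‖ψ x‖ ^ 2 := by
  have key : ∀ φ : ι → ℂ, ((∑ x, ‖φ x‖ ^ 2 : ℝ) : ℂ) = star φ ⬝ᵥ φ := by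
    intro φ
    push_cast
    refine Finset.sum_congr rfl fun x _ => ?_
    rw [Pi.star_apply, ← Complex.conj_mul']
    rfl
  have h : ((∑ x, ‖U.mulVec ψ x‖ ^ 2 : ℝ) : ℂ) = ((∑ x, ‖ψ x‖ ^ 2 : ℝ) : ℂ) := by
    rw [key, key, Matrix.star_mulVec, Matrix.dotProduct_mulVec, Matrix.vecMul_vecMul,
      ← Matrix.star_eq_conjTranspose, (Matrix.mem_unitaryGroup_iff'.1 hU), Matrix.vecMul_one]
  exact_mod_cast h

lemma oracleMatrix_mem_unitaryGroup (w : ℕ) (f : Fin n → Fin N) :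
    oracleMatrix w f ∈ Matrix.unitaryGroup (BasisLabel n N w) ℂ := by
  rw [Matrix.mem_unitaryGroup_iff']
  ext x y
  have hinj : ∀ x y : BasisLabel n N w,
      (x.1, f x.1 + x.2.1, x.2.2) = (y.1, f y.1 + y.2.1, y.2.2) → x = y := by
    rintro ⟨i, j, z⟩ ⟨i', j', z'⟩ h
    simp only [Prod.mk.injEq] at h ⊢
    obtain ⟨rfl, h2, rfl⟩ := h
    have : NeZero N := ⟨fun h0 => (Fin.cast h0 j).elim0⟩
    exact ⟨rfl, add_left_cancel h2, rfl⟩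
  rw [Matrix.mul_apply, Finset.sum_eq_single (x.1, f x.1 + x.2.1, x.2.2)]
  · simp only [Matrix.star_apply, oracleMatrix, Matrix.of_apply, if_true, star_one, one_mul,
      Matrix.one_apply]
    by_cases hxy : x = y
    · simp [hxy]
    · rw [if_neg fun h => hxy (hinj x y h), if_neg hxy]
  · intro z _ hz
    simp [oracleMatrix, hz]
  · simp

lemma sum_norm_sq_state (A : QuantumQueryAlgorithm n N) (f : Fin n → Fin N) (k : ℕ) :
    ∑ x, ‖A.state f k x‖ ^ 2 = 1 := by
  induction k with
  | zero =>
    rw [QuantumQueryAlgorithm.state, sum_norm_sq_mulVec_of_unitary (A.U 0).2,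
      Finset.sum_eq_single A.start] <;> simp +contextual
  | succ k ih =>
    rw [QuantumQueryAlgorithm.state, sum_norm_sq_mulVec_of_unitary (A.U (k + 1)).2,
      sum_norm_sq_mulVec_of_unitary (oracleMatrix_mem_unitaryGroup _ f), ih]

lemma acceptProb_mem_Icc (A : QuantumQueryAlgorithm n N) (f : Fin n → Fin N) :
    A.acceptProb f ∈ Set.Icc (0 : ℝ) 1 := by
  refine ⟨Finset.sum_nonneg fun _ _ => by positivity, ?_⟩
  rw [← sum_norm_sq_state A f A.numQueries]
  exact Finset.sum_le_sum_of_subset_of_nonneg (Finset.subset_univ _) fun _ _ _ => by positivity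

/-! ### Averaged acceptance probabilities -/

/-- Functions with `p` fibres of size `a` and `q` fibres of size `b` exist if the sizes add up. -/
lemma exists_isTwoSized {n p q a b : ℕ} (ha : 1 ≤ a) (hb : 1 ≤ b) (hn : p * a + q * b = n) :
    ∃ (f : Fin n → Fin n) (A B : Finset (Fin n)), A.card = p ∧ B.card = q ∧
      IsTwoSized (fun y => (Finset.univ.filter fun x => f x = y).card) a b A B := by
  have hcard : Fintype.card (Fin n) = Fintype.card (Fin p × Fin a ⊕ Fin q × Fin b) := by
    simp [hn]
  set e : Fin n ≃ Fin p × Fin a ⊕ Fin q × Fin b := Fintype.equivOfCardEq hcard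
  obtain ⟨g⟩ : Nonempty (Fin p ⊕ Fin q ↪ Fin n) := by
    refine Function.Embedding.nonempty_of_card_le ?_
    simp only [Fintype.card_sum, Fintype.card_fin]
    nlinarith
  refine ⟨fun x => g (Sum.map Prod.fst Prod.fst (e x)),
    Finset.univ.map (Function.Embedding.inl.trans g),
    Finset.univ.map (Function.Embedding.inr.trans g), by simp, by simp, ?_, ?_, ?_, ?_⟩
  · rw [Finset.disjoint_left]
    simp
  · intro y hy
    obtain ⟨u, -, rfl⟩ := Finset.mem_map.1 hy
    have h : (Finset.univ.filter fun x => g (Sum.map Prod.fst Prod.fst (e x)) = g (Sum.inl u))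
        = Finset.univ.map (((Function.Embedding.sectR u (Fin a)).trans
          Function.Embedding.inl).trans e.symm.toEmbedding) := by
      ext x
      obtain ⟨z, rfl⟩ := e.symm.surjective x
      rcases z with ⟨u', k⟩ | ⟨u', k⟩ <;> simp [eq_comm]
    change (Finset.univ.filter fun x =>
      g (Sum.map Prod.fst Prod.fst (e x)) = g (Sum.inl u)).card = a
    rw [h, Finset.card_map, Finset.card_univ, Fintype.card_fin]
  · intro y hy
    obtain ⟨u, -, rfl⟩ := Finset.mem_map.1 hy
    have h : (Finset.univ.filter fun x => g (Sum.map Prod.fst Prod.fst (e x)) = g (Sum.inr u))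
        = Finset.univ.map (((Function.Embedding.sectR u (Fin b)).trans
          Function.Embedding.inr).trans e.symm.toEmbedding) := by
      ext x
      obtain ⟨z, rfl⟩ := e.symm.surjective x
      rcases z with ⟨u', k⟩ | ⟨u', k⟩ <;> simp [eq_comm]
    change (Finset.univ.filter fun x =>
      g (Sum.map Prod.fst Prod.fst (e x)) = g (Sum.inr u)).card = b
    rw [h, Finset.card_map, Finset.card_univ, Fintype.card_fin]
  · intro y hA hB
    rw [Finset.card_eq_zero, Finset.filter_eq_empty_iff]
    rintro x - rfl
    rcases h : Sum.map Prod.fst Prod.fst (e x) with u | u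
    · exact hA (by simp [h])
    · exact hB (by simp [h])

lemma injective_of_isTwoSized_one {n : ℕ} {f : Fin n → Fin n} {A B : Finset (Fin n)}
    (h : IsTwoSized (fun y => (Finset.univ.filter fun x => f x = y).card) 1 1 A B) :
    Function.Injective f := by
  intro x x' hxx
  have h1 : (Finset.univ.filter fun z => f z = f x).card ≤ 1 := by
    by_cases hA : f x ∈ A
    · exact (h.eq_left _ hA).le
    by_cases hB : f x ∈ B
    · exact (h.eq_right _ hB).le
    exact (h.eq_zero _ hA hB).le.trans zero_le_one
  exact Finset.card_le_one.1 h1 x (by simp) x' (by simp [hxx])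

lemma isToOne_of_isTwoSized {n r : ℕ} {f : Fin n → Fin n} {A B : Finset (Fin n)}
    (h : IsTwoSized (fun y => (Finset.univ.filter fun x => f x = y).card) r r A B) :
    IsToOne r f := by
  rintro _ ⟨x, rfl⟩
  by_cases hA : f x ∈ A
  · exact h.eq_left _ hA
  by_cases hB : f x ∈ B
  · exact h.eq_right _ hB
  have := Finset.card_eq_zero.1 (h.eq_zero _ hA hB)
  exact absurd this (Finset.ne_empty_of_mem (Finset.mem_filter.2 ⟨Finset.mem_univ x, rfl⟩))

lemma isToOne_comp {n r : ℕ} {f : Fin n → Fin n} (h : IsToOne r f) (σ τ : Equiv.Perm (Fin n)) :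
    IsToOne r (τ ∘ f ∘ σ) := by
  rintro _ ⟨x, rfl⟩
  rw [← h (f (σ x)) ⟨_, rfl⟩, ← Finset.card_map σ.toEmbedding]
  congr 1
  ext y
  simp only [Function.comp_apply, EmbeddingLike.apply_eq_iff_eq, Finset.mem_map_equiv,
    Finset.mem_filter, Finset.mem_univ, true_and, Equiv.apply_symm_apply]

/-- The symmetrized acceptance probability of an algorithm with `T` queries is a polynomial `Q` of
degree at most `2 T` in the parameters `(p a, q b, a, b)` of functions that have `p` fibres of size
`a` and `q` fibres of size `b`. -/
lemma exists_symmetrized_polynomial {n r : ℕ} {ε : ℝ} (hr : 1 ≤ r)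
    (A : QuantumQueryAlgorithm n n) (hA : A.Distinguishes r ε) :
    ∃ Q : MvPolynomial (Fin 4) ℝ, Q.totalDegree ≤ 2 * A.numQueries ∧
      (∀ p q a b : ℕ, 1 ≤ a → 1 ≤ b → p * a + q * b = n →
        MvPolynomial.eval ![(p : ℝ) * a, (q : ℝ) * b, (a : ℝ), (b : ℝ)] Q ∈ Set.Icc (0 : ℝ) 1) ∧
      (∀ p q : ℕ, p + q = n → MvPolynomial.eval ![(p : ℝ), (q : ℝ), 1, 1] Q ≤ ε) ∧
      (∀ p q : ℕ, p * r + q * r = n →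
        1 - ε ≤ MvPolynomial.eval ![(p : ℝ) * r, (q : ℝ) * r, (r : ℝ), (r : ℝ)] Q) := by
  obtain ⟨F, hFdeg, hF⟩ := exists_mvPolynomial_average (acceptProb_mem_lowDegree A)
  set K : ℝ := (Fintype.card (Equiv.Perm (Fin n)) : ℝ) with hK
  have hKpos : 0 < K := by rw [hK]; exact_mod_cast Fintype.card_pos
  have hle : ∀ (f : Fin n → Fin n) (a b : ℕ) (S S' : Finset (Fin n)) (hi : ℝ),
      IsTwoSized (fun y => (Finset.univ.filter fun x => f x = y).card) a b S S' →
      (∀ σ τ : Equiv.Perm (Fin n), A.acceptProb (τ ∘ f ∘ σ) ≤ hi) →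
      MvPolynomial.eval (fibreParams a b S S') (MvPolynomial.C (K * K)⁻¹ * F) ≤ hi := by
    intro f a b S S' hi hf hP
    rw [map_mul, MvPolynomial.eval_C, ← hF f a b S S' hf, inv_mul_le_iff₀ (by positivity)]
    refine (Finset.sum_le_sum fun σ _ => Finset.sum_le_sum fun τ _ => hP σ τ).trans_eq ?_
    simp only [Finset.sum_const, Finset.card_univ, nsmul_eq_mul, ← hK, mul_assoc]
  have hge : ∀ (f : Fin n → Fin n) (a b : ℕ) (S S' : Finset (Fin n)) (lo : ℝ),
      IsTwoSized (fun y => (Finset.univ.filter fun x => f x = y).card) a b S S' →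
      (∀ σ τ : Equiv.Perm (Fin n), lo ≤ A.acceptProb (τ ∘ f ∘ σ)) →
      lo ≤ MvPolynomial.eval (fibreParams a b S S') (MvPolynomial.C (K * K)⁻¹ * F) := by
    intro f a b S S' lo hf hP
    rw [map_mul, MvPolynomial.eval_C, ← hF f a b S S' hf, le_inv_mul_iff₀ (by positivity)]
    refine Eq.trans_le ?_ (Finset.sum_le_sum fun σ _ => Finset.sum_le_sum fun τ _ => hP σ τ)
    simp only [Finset.sum_const, Finset.card_univ, nsmul_eq_mul, ← hK, mul_assoc]
  refine ⟨MvPolynomial.C (K * K)⁻¹ * F, (MvPolynomial.totalDegree_mul _ _).trans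
    (by rwa [MvPolynomial.totalDegree_C, zero_add]), ?_, ?_, ?_⟩
  · intro p q a b ha hb hn
    obtain ⟨f, S, S', rfl, rfl, hf⟩ := exists_isTwoSized ha hb hn
    exact ⟨hge f a b S S' 0 hf fun σ τ => (acceptProb_mem_Icc A _).1,
      hle f a b S S' 1 hf fun σ τ => (acceptProb_mem_Icc A _).2⟩
  · intro p q hn
    obtain ⟨f, S, S', rfl, rfl, hf⟩ := exists_isTwoSized (p := p) (q := q) le_rfl le_rfl
      (by simpa using hn)
    have hinj := injective_of_isTwoSized_one hf
    have := hle f 1 1 S S' ε hf fun σ τ => hA.1 _ (τ.injective.comp (hinj.comp σ.injective))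
    simpa [fibreParams] using this
  · intro p q hn
    obtain ⟨f, S, S', rfl, rfl, hf⟩ := exists_isTwoSized (p := p) (q := q) hr hr hn
    exact hge f r r S S' (1 - ε) hf fun σ τ => hA.2 _ (isToOne_comp (isToOne_of_isTwoSized hf) σ τ)

/-! ### The degree bound -/

lemma exists_restriction_to_line {Q : MvPolynomial (Fin 4) ℝ} {d : ℕ} (hQ : Q.totalDegree ≤ d)
    (α β : Fin 4 → ℝ) :
    ∃ g : ℝ[X], g.natDegree ≤ d ∧
      ∀ t, g.eval t = MvPolynomial.eval (fun i => α i + β i * t) Q := by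
  refine ⟨MvPolynomial.aeval (fun i => C (α i) + C (β i) * X) Q, ?_, fun t => ?_⟩
  · have := MvPolynomial.aeval_natDegree_le (n := 1) Q hQ (fun i => C (α i) + C (β i) * X)
      fun i => by compute_degree
    simpa using this
  · rw [← coe_evalRingHom, MvPolynomial.aeval_def, MvPolynomial.hom_eval₂, MvPolynomial.eval]
    simp only [MvPolynomial.coe_eval₂Hom]
    congr 1
    · ext; simp
    · ext i; simp

/-- A polynomial that jumps near the left end of the positive axis becomes large at some positive
integer `k`.  The least such `k` gives a long interval on which the polynomial is bounded at the
integers, so that `k` is bounded by the square of the degree. -/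
lemma exists_large_value {g : ℝ[X]} {d : ℕ} (hg : g.natDegree ≤ d) (hd : 1 ≤ d) {u δ ρ : ℝ} {m : ℕ}
    (hu0 : 0 ≤ u) (hu1 : u ≤ 1) (hum : u + 1 / 2 ≤ m) (hmρ : (m : ℝ) ≤ ρ) (hρ : 1 ≤ ρ) (hδ : 0 < δ)
    (hδ1 : δ ≤ 1) (hgu : |g.eval u| ≤ 200) (hjump : δ ≤ |g.eval u - g.eval (m : ℝ)|) :
    ∃ k : ℕ, 1 ≤ k ∧ 200 < |g.eval (k : ℝ)| ∧ δ * k / (6400 * ρ) ≤ (d : ℝ) ^ 2 := by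
  have hgdeg : 0 < g.degree := by
    by_contra! h
    rw [eq_C_of_degree_le_zero h] at hjump
    simp only [eval_C, sub_self, abs_zero] at hjump
    linarith
  have hex : ∃ k : ℕ, 1 ≤ k ∧ 200 < |g.eval (k : ℝ)| := by
    have h := (Polynomial.abs_tendsto_atTop g hgdeg).comp tendsto_natCast_atTop_atTop
    have h2 := (h.eventually_gt_atTop 200).and (Filter.eventually_ge_atTop 1)
    obtain ⟨k, hk1, hk2⟩ := h2.exists
    exact ⟨k, hk2, hk1⟩
  classical
  set k := Nat.find hex with hk
  obtain ⟨hk1, hk2⟩ := Nat.find_spec hex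
  refine ⟨k, hk1, hk2, ?_⟩
  have hmin : ∀ j : ℕ, 1 ≤ j → j < k → |g.eval (j : ℝ)| ≤ 200 := by
    intro j hj1 hj2
    have := Nat.find_min hex hj2
    simpa [hj1] using this
  rcases lt_or_ge m k with hmk | hmk
  · have hm1 : 1 ≤ m := by
      have : (0 : ℝ) < m := by linarith
      exact_mod_cast this
    have hmk' : (m : ℝ) + 1 ≤ k := by exact_mod_cast hmk
    have hlen : (k : ℝ) / 4 ≤ (k - 1) - u := by
      rcases Nat.lt_or_ge k 3 with h3 | h3
      · have : (k : ℝ) ≤ 2 := by exact_mod_cast Nat.lt_succ_iff.1 h3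
        linarith
      · have : (3 : ℝ) ≤ k := by exact_mod_cast h3
        linarith
    have hkpos : (0 : ℝ) < k := by exact_mod_cast hk1
    have key := degree_sq_ge_of_jump (p := g) (u := u) (v := k - 1) (C₀ := 200) hg (by linarith) hδ
      (by linarith) hρ ?_ (x₁ := u) (x₂ := m) ⟨le_rfl, by linarith⟩ ⟨by linarith, by linarith⟩
      ?_ hjump
    · refine le_trans ?_ key
      rw [div_le_div_iff₀ (by positivity) (by positivity)]
      have := mul_le_mul_of_nonneg_left hlen (by positivity : 0 ≤ δ * (6400 * ρ))
      linarith
    · rintro x ⟨hx1, hx2⟩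
      rcases lt_or_ge x 1 with hx | hx
      · exact ⟨u, ⟨le_rfl, by linarith⟩, by rw [abs_of_nonneg] <;> linarith, hgu⟩
      · have h1 : (⌊x⌋₊ : ℝ) ≤ x := Nat.floor_le (by linarith)
        have h2 : x < ⌊x⌋₊ + 1 := Nat.lt_floor_add_one x
        have h3 : 1 ≤ ⌊x⌋₊ := Nat.le_floor (by simpa using hx)
        have h4 : (1 : ℝ) ≤ ⌊x⌋₊ := by exact_mod_cast h3
        refine ⟨⌊x⌋₊, ⟨by linarith, by linarith⟩, by rw [abs_of_nonneg] <;> linarith,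
          hmin _ h3 ?_⟩
        have : (⌊x⌋₊ : ℝ) < k := by linarith
        exact_mod_cast this
    · rw [abs_of_nonpos] <;> linarith
  · have h1 : (k : ℝ) ≤ ρ := le_trans (by exact_mod_cast hmk) hmρ
    have h2 : (1 : ℝ) ≤ d := by exact_mod_cast hd
    rw [div_le_iff₀ (by positivity)]
    have h3 : δ * k ≤ 1 * ρ := by gcongr
    have h4 : ρ ≤ (d : ℝ) ^ 2 * ρ := le_mul_of_one_le_left (by linarith) (one_le_pow₀ h2)
    linarith

lemma cube_ge_of_bounds {d k W ρ δ : ℝ} (hk : 0 < k) (hρ : 0 < ρ) (hW : 0 ≤ W)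
    (h1 : δ * k / (6400 * ρ) ≤ d ^ 2) (h2 : W / (3 * k) ≤ d) : δ / 19200 * (W / ρ) ≤ d ^ 3 := by
  calc δ / 19200 * (W / ρ) = δ * k / (6400 * ρ) * (W / (3 * k)) := by field_simp; ring
    _ ≤ d ^ 2 * d := by gcongr
    _ = d ^ 3 := by ring

/-- A polynomial that behaves like a symmetrized acceptance probability has a large degree.  For
functions with about half of their points in fibres of size `1` and the others in fibres of size `r`,
its value is either at least `1 / 2`, or less.  Accordingly, it jumps when the fibre size on one of
the two halves is changed from `r` to `1`, or from `1` to `r`.  Let this size grow to a value `k` (in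
the second case `r k`) at which the polynomial is large.  If `k` is large, then so is the degree,
because the polynomial was bounded before.  If `k` is small, then the degree is large because the
polynomial is bounded when other numbers of points are put in fibres of this size. -/
lemma degree_cube_ge {Q : MvPolynomial (Fin 4) ℝ} {d n r : ℕ} {ε : ℝ} (hQ : Q.totalDegree ≤ d)
    (hε₀ : 0 ≤ ε) (hε : ε < 1 / 2) (hn : 0 < n) (hr : 2 ≤ r) (hrn : r ∣ n)
    (hval : ∀ p q a b : ℕ, 1 ≤ a → 1 ≤ b → p * a + q * b = n →
      MvPolynomial.eval ![(p : ℝ) * a, (q : ℝ) * b, (a : ℝ), (b : ℝ)] Q ∈ Set.Icc (0 : ℝ) 1)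
    (hone : ∀ p q : ℕ, p + q = n → MvPolynomial.eval ![(p : ℝ), (q : ℝ), 1, 1] Q ≤ ε)
    (hmany : ∀ p q : ℕ, p * r + q * r = n →
      1 - ε ≤ MvPolynomial.eval ![(p : ℝ) * r, (q : ℝ) * r, (r : ℝ), (r : ℝ)] Q) :
    (1 / 2 - ε) / 19200 * ((n : ℝ) / r) ≤ (d : ℝ) ^ 3 := by
  set V : ℝ → ℝ → ℝ → ℝ → ℝ := fun m l a b => MvPolynomial.eval ![m, l, a, b] Q with hV
  have hline : ∀ m m' l l' a a' b b' : ℝ, ∃ g : ℝ[X], g.natDegree ≤ d ∧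
      ∀ t, g.eval t = V (m + m' * t) (l + l' * t) (a + a' * t) (b + b' * t) := by
    intro m m' l l' a a' b b'
    obtain ⟨g, hg, h⟩ := exists_restriction_to_line hQ ![m, l, a, b] ![m', l', a', b']
    refine ⟨g, hg, fun t => (h t).trans ?_⟩
    simp only [hV]
    congr 2
    funext i
    fin_cases i <;> rfl
  have habs : ∀ x ∈ Set.Icc (0 : ℝ) 1, |x| ≤ 1 := fun x hx => abs_le.2 ⟨by linarith [hx.1], hx.2⟩
  obtain ⟨s, rfl⟩ := hrn
  have hs : 1 ≤ s := Nat.pos_of_mul_pos_left hn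
  have hrpos : (0 : ℝ) < r := by positivity
  have hr2 : (2 : ℝ) ≤ r := by exact_mod_cast hr
  -- A constant polynomial cannot separate one-to-one from `r`-to-one functions.
  have hd : 1 ≤ d := by
    by_contra! h0
    obtain ⟨g, hg, hgV⟩ := hline 0 0 (r * s) 0 1 (r - 1) 1 (r - 1)
    rw [eq_C_of_natDegree_le_zero (hg.trans (Nat.lt_one_iff.1 h0).le)] at hgV
    have h1 := hgV 0
    have h2 := hgV 1
    have h3 := hone 0 (r * s) (by simp)
    have h4 := hmany 0 s (by ring)
    simp only [hV, eval_C] at h1 h2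
    norm_num at h1 h2 h3 h4
    rw [mul_comm (s : ℝ)] at h4
    rw [h1] at h2
    linarith
  have hnr : ((r * s : ℕ) : ℝ) / r = s := by push_cast; field_simp
  rw [hnr]
  have hdR : (1 : ℝ) ≤ d := by exact_mod_cast hd
  -- For `n = r` there are no two nonempty parts, and `d ≥ 1` suffices.
  rcases hs.eq_or_lt with rfl | hs2
  · have : (1 : ℝ) ≤ (d : ℝ) ^ 3 := one_le_pow₀ hdR
    push_cast
    linarith
  -- The two parts have `r p` and `r q` points, each at least a third of `n = r s`.
  set p := s / 2 with hp
  set q := s - s / 2 with hq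
  have hpq : p + q = s := by omega
  have hpqR : (p : ℝ) + q = s := by exact_mod_cast hpq
  have h3p : (s : ℝ) ≤ 3 * p := by exact_mod_cast (by omega : s ≤ 3 * p)
  have h3q : (s : ℝ) ≤ 3 * q := by exact_mod_cast (by omega : s ≤ 3 * q)
  have hsR : (2 : ℝ) ≤ s := by exact_mod_cast hs2
  have hmid := hval (r * p) q 1 r le_rfl (by omega) (by rw [← hpq]; ring)
  have hone' := hone (r * p) (r * q) (by rw [← hpq]; ring)
  have hmany' := hmany p q (by rw [← hpq]; ring)
  push_cast at hmid hone' hmany'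
  rw [mul_one, mul_comm (q : ℝ)] at hmid
  rw [mul_comm (p : ℝ), mul_comm (q : ℝ)] at hmany'
  rcases le_or_gt (1 / 2) (V (r * p) (r * q) 1 r) with hcase | hcase
  · -- The size of the fibres of size `r` varies.
    obtain ⟨g, hg, hgV⟩ := hline (r * p) 0 (r * q) 0 1 0 0 1
    simp only [zero_mul, add_zero, zero_add, one_mul] at hgV
    have hg1 : g.eval 1 ∈ Set.Icc (0 : ℝ) 1 := by
      rw [hgV]
      have := hval (r * p) (r * q) 1 1 le_rfl le_rfl (by rw [← hpq]; ring)
      simpa [hV] using this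
    obtain ⟨k, hk1, hk2, hk3⟩ := exists_large_value (u := 1) (m := r) (δ := 1 / 2 - ε) (ρ := r)
      hg hd zero_le_one le_rfl (by linarith) le_rfl (by linarith) (by linarith) (by linarith)
      ((habs _ hg1).trans (by norm_num)) (by
        rw [hgV, hgV]
        refine le_trans ?_ (neg_le_abs _)
        change V _ _ _ _ ≤ ε at hone'
        linarith)
    have hkR : (0 : ℝ) < k := by exact_mod_cast hk1
    -- Now the number `t` of fibres of size `k` varies; the value at `t = r q / k` is `g k`.
    obtain ⟨h, hh, hhV⟩ := hline (r * s) (-k) 0 k 1 0 k 0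
    simp only [zero_mul, add_zero, zero_add] at hhV
    have hdk := min_lt_degree_of_large_value (L := r * s / k) (t₀ := r * q / k) hh
      (fun j hj => ?_) (by positivity) ?_
    · have := cube_ge_of_bounds (W := r * s) hkR hrpos (by positivity) hk3 (hdk.le.trans' ?_)
      · rwa [mul_div_cancel_left₀ _ hrpos.ne'] at this
      · rw [← sub_div, ← mul_sub, ← hpqR, add_sub_cancel_right]
        refine le_min ?_ ?_ <;> rw [div_le_div_iff₀ (by positivity) hkR, hpqR] <;>
          nlinarith [mul_pos hrpos hkR]
    · rw [le_div_iff₀ hkR] at hj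
      have hj' : j * k ≤ r * s := by exact_mod_cast hj
      have := hval (r * s - j * k) j 1 k le_rfl hk1 (by omega)
      rw [Nat.cast_sub hj'] at this
      push_cast at this
      rw [hhV, mul_comm (k : ℝ), show (r : ℝ) * s + -k * j = (r * s - j * k) * 1 by ring]
      exact habs _ this
    · rw [hhV]
      rw [hgV] at hk2
      convert hk2 using 3
      · field_simp; rw [← hpqR]; ring
      · field_simp
  · -- The size of the fibres of size `1` varies, first up to `r` and then through multiples of `r`.
    obtain ⟨g, hg, hgV⟩ := hline (r * p) 0 (r * q) 0 0 r r 0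
    simp only [zero_mul, add_zero, zero_add] at hgV
    have hgr : g.eval (1 / r : ℝ) = V (r * p) (r * q) 1 r := by
      rw [hgV, mul_one_div_cancel hrpos.ne']
    obtain ⟨k, hk1, hk2, hk3⟩ := exists_large_value (u := 1 / r) (m := 1) (δ := 1 / 2 - ε) (ρ := 1)
      hg hd (by positivity) (by rw [div_le_one hrpos]; linarith)
      (by
        have : 1 / (r : ℝ) ≤ 1 / 2 := one_div_le_one_div_of_le (by norm_num) hr2
        push_cast; linarith) (by simp) le_rfl (by linarith) (by linarith)
      (by rw [hgr]; exact (habs _ hmid).trans (by norm_num)) (by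
        rw [hgr, hgV]
        refine le_trans ?_ (neg_le_abs _)
        push_cast
        rw [mul_one]
        change _ ≤ V _ _ _ _ at hmany'
        linarith)
    have hkR : (0 : ℝ) < k := by exact_mod_cast hk1
    -- Now the number `t` of fibres of size `r k` varies; the value at `t = p / k` is `g k`.
    obtain ⟨h, hh, hhV⟩ := hline 0 (r * k) (r * s) (-(r * k)) (r * k) 0 r 0
    simp only [zero_mul, add_zero, zero_add] at hhV
    have hdk := min_lt_degree_of_large_value (L := s / k) (t₀ := p / k) hh
      (fun j hj => ?_) (by positivity) ?_
    · have := cube_ge_of_bounds (W := s) hkR one_pos (by positivity) hk3 (hdk.le.trans' ?_)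
      · rwa [div_one] at this
      · rw [← sub_div, ← hpqR, add_sub_cancel_left]
        refine le_min ?_ ?_ <;> rw [div_le_div_iff₀ (by positivity) hkR, hpqR] <;> nlinarith
    · rw [le_div_iff₀ hkR] at hj
      have hj' : j * k ≤ s := by exact_mod_cast hj
      have := hval j (s - j * k) (r * k) r (Nat.mul_pos (by omega) hk1) (by omega) (by
        obtain ⟨i, hi⟩ := Nat.exists_eq_add_of_le hj'
        rw [hi, Nat.add_sub_cancel_left]; ring)
      rw [Nat.cast_sub hj'] at this
      push_cast at this
      rw [hhV, show (r : ℝ) * k * j = j * (r * k) by ring,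
        show (r : ℝ) * s + -(r * k) * j = (s - j * k) * r by ring]
      exact habs _ this
    · rw [hhV]
      rw [hgV] at hk2
      convert hk2 using 3
      · field_simp
      · field_simp; rw [← hpqR]; ring

end CollisionLowerBound

theorem theorem1 (ε : ℝ) (hε₀ : 0 ≤ ε) (hε : ε < 1 / 2) :
    ∃ c : ℝ, 0 < c ∧
      ∀ n r : ℕ, 0 < n → 2 ≤ r → r ∣ n →
        ∀ A : QuantumQueryAlgorithm n n, A.Distinguishes r ε →
          c * ((n : ℝ) / (r : ℝ)) ^ (1 / 3 : ℝ) ≤ (A.numQueries : ℝ) := by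
  have hδ : 0 < (1 / 2 - ε) / 19200 := by linarith
  refine ⟨((1 / 2 - ε) / 19200) ^ (1 / 3 : ℝ) / 2, by positivity, fun n r hn hr hrn A hA => ?_⟩
  obtain ⟨Q, hQ, hval, hone, hmany⟩ :=
    CollisionLowerBound.exists_symmetrized_polynomial (by omega) A hA
  have h := CollisionLowerBound.degree_cube_ge hQ hε₀ hε hn hr hrn hval hone hmany
  have h2 := Real.rpow_le_rpow (by positivity) h (by norm_num : (0 : ℝ) ≤ 1 / 3)
  rw [Real.mul_rpow hδ.le (by positivity), ← Real.rpow_natCast, ← Real.rpow_mul (by positivity)]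
    at h2
  norm_num at h2 ⊢
  linarith
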